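/- Let $d\ge 1$ and $J\ge 2$, and let $\lambda_0,\dots,\lambda_{J-1}\ge 0$ with $\sum_j\lambda_j=1$. For $j=0,\dots,J-1$ let $\mu_j=\sum_{k=1}^{K_j}\pi_j^k\mu_j^k$ be a Gaussian mixture on $\mathbb R^d$, where $\pi_j^k\ge 0$, $\sum_k\pi_j^k=1$, and $\mu_j^k=\mathcal N(m_j^k,\Sigma_j^k)$ with every $\Sigma_j^k$ positive definite. Notation. $GMM_n(\infty)$ is the set of all finite Gaussian mixtures on $\mathbb R^n$ (degenerate components allowed), $\mathcal P_2(\mathbb R^d)$ is the set of probability measures with finite second moment, and $\Pi(\cdot)$ is the set of probability measures with the given marginals. Put $$W_2^2(\mu,\nu)=\inf_{\gamma\in\Pi(\mu,\nu)}\int\|x-y\|^2\,d\gamma(x,y),\qquad MW_2^2(\mu,\nu)=\inf_{\gamma\in\Pi(\mu,\nu)\cap GMM_{2d}(\infty)}\int\|x-y\|^2\,d\gamma(x,y),$$ $$mmW_2^2(\rho_0,\dots,\rho_{J-1})=\inf_{\gamma\in\Pi(\rho_0,\dots,\rho_{J-1})}\int\frac12\sum_{i,j=0}^{J-1}\lambda_i\lambda_j\|y_i-y_j\|^2\,d\gamma(y_0,\dots,y_{J-1}).$$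 A $W_2$ barycenter of $\rho_0,\dots,\rho_{J-1}$ is a minimizer of $\nu\mapsto\sum_j\lambda_jW_2^2(\rho_j,\nu)$ over $\mathcal P_2(\mathbb R^d)$. An $MW_2$ barycenter of $\mu_0,\dots,\mu_{J-1}$ is a minimizer of $\nu\mapsto\sum_j\lambda_jMW_2^2(\mu_j,\nu)$ over $GMM_d(\infty)$. The discrete multi-marginal program is to minimize $$\sum_{k_0,\dots,k_{J-1}}w_{k_0\dots k_{J-1}}\,mmW_2^2(\mu_0^{k_0},\dots,\mu_{J-1}^{k_{J-1}})$$ over all nonnegative tensors $w$ of size $K_0\times\dots\times K_{J-1}$ with $\sum_{(k_0,\dots,k_{J-1}):\,k_j=k}w_{k_0\dots k_{J-1}}=\pi_j^k$ for all $j$ and $k$. Then: 1. For all $k_0,\dots,k_{J-1}$ the components $\mu_0^{k_0},\dots,\mu_{J-1}^{k_{J-1}}$ have a unique $W_2$ barycenter $\nu_{k_0\dots k_{J-1}}$, and it is Gaussian. 2. A measure $\nu$ is an $MW_2$ barycenter of $\mu_0,\dots,\mu_{J-1}$ if and only if $$\nu=\sum_{k_0,\dots,k_{J-1}}w^*_{k_0\dots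 k_{J-1}}\,\nu_{k_0\dots k_{J-1}}$$ for some solution $w^*$ of the discrete multi-marginal program. 3. The discrete program has a solution $w^*$ with at most $K_0+\dots+K_{J-1}-J+1$ nonzero coefficients; hence there is an $MW_2$ barycenter of this form with at most that many nonzero weights. -/

import Mathlib

open MeasureTheory ProbabilityTheory
open scoped NNReal ENNReal

noncomputable section

namespace GMMOT

/-- Euclidean space `ℝ^d`, with its Euclidean norm. -/
abbrev Rd (d : ℕ) : Type := EuclideanSpace ℝ (Fin d)

/-- Gaussian mixtures with (at most) `K` components on a real topological vector space `E`
(below `E = ℝ^d` or `E = ℝ^d × ℝ^d`). The components may be degenerate and the weights may vanish. -/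
def GMM (E : Type*) [TopologicalSpace E] [AddCommMonoid E] [Module ℝ E] [MeasurableSpace E]
    (K : ℕ) : Set (Measure E) :=
  {μ | ∃ (p : Fin K → ℝ≥0) (g : Fin K → Measure E),
    ∑ k, p k = 1 ∧ (∀ k, IsGaussian (g k)) ∧ μ = ∑ k, p k • g k}

/-- All finite Gaussian mixtures on `E`. -/
def GMMInf (E : Type*) [TopologicalSpace E] [AddCommMonoid E] [Module ℝ E] [MeasurableSpace E] :
    Set (Measure E) :=
  ⋃ K : ℕ, GMM E K

/-- Probability measures on `ℝ^d` with a finite second moment. -/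
def P2 (d : ℕ) : Set (Measure (Rd d)) :=
  {μ | IsProbabilityMeasure μ ∧ ∫⁻ x, ‖x‖ₑ ^ 2 ∂μ < ∞}

/-- Probability measures on `ℝ^d × ℝ^d` with marginals `μ` and `ν`. -/
def couplings {d : ℕ} (μ ν : Measure (Rd d)) : Set (Measure (Rd d × Rd d)) :=
  {γ | IsProbabilityMeasure γ ∧ γ.map Prod.fst = μ ∧ γ.map Prod.snd = ν}

/-- Probability measures on `(ℝ^d)^J` with marginals `μ 0, …, μ (J - 1)`. -/
def multiCouplings {d J : ℕ} (μ : Fin J → Measure (Rd d)) : Set (Measure (Fin J → Rd d)) :=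
  {γ | IsProbabilityMeasure γ ∧ ∀ j, γ.map (fun y => y j) = μ j}

/-- The squared Wasserstein distance `W₂²`. -/
def W2sq {d : ℕ} (μ ν : Measure (Rd d)) : ℝ≥0∞ :=
  ⨅ γ ∈ couplings μ ν, ∫⁻ y, ‖y.1 - y.2‖ₑ ^ 2 ∂γ

/-- The squared distance `MW₂²`: the transport plans have to be Gaussian mixtures. -/
def MW2sq {d : ℕ} (μ ν : Measure (Rd d)) : ℝ≥0∞ :=
  ⨅ γ ∈ couplings μ ν ∩ GMMInf (Rd d × Rd d), ∫⁻ y, ‖y.1 - y.2‖ₑ ^ 2 ∂γ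

/-- The multi-marginal transport cost `mmW₂²` with weights `lam`. -/
def mmW2sq {d J : ℕ} (lam : Fin J → ℝ≥0) (μ : Fin J → Measure (Rd d)) : ℝ≥0∞ :=
  ⨅ γ ∈ multiCouplings μ,
    ∫⁻ y, (1 / 2) * ∑ i, ∑ j, (lam i : ℝ≥0∞) * (lam j : ℝ≥0∞) * ‖y i - y j‖ₑ ^ 2 ∂γ

/-- `ν` is a `W₂` barycenter of the `μ j` with weights `lam j`. -/
def IsW2Barycenter {d J : ℕ} (lam : Fin J → ℝ≥0) (μ : Fin J → Measure (Rd d))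
    (ν : Measure (Rd d)) : Prop :=
  ν ∈ P2 d ∧ ∀ ρ ∈ P2 d,
    ∑ j, (lam j : ℝ≥0∞) * W2sq (μ j) ν ≤ ∑ j, (lam j : ℝ≥0∞) * W2sq (μ j) ρ

/-- `ν` is an `MW₂` barycenter of the `μ j` with weights `lam j`. -/
def IsMW2Barycenter {d J : ℕ} (lam : Fin J → ℝ≥0) (μ : Fin J → Measure (Rd d))
    (ν : Measure (Rd d)) : Prop :=
  ν ∈ GMMInf (Rd d) ∧ ∀ ρ ∈ GMMInf (Rd d),
    ∑ j, (lam j : ℝ≥0∞) * MW2sq (μ j) ν ≤ ∑ j, (lam j : ℝ≥0∞) * MW2sq (μ j) ρ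

/-- Nonnegative tensors of size `K 0 × ⋯ × K (J - 1)` whose discrete marginals are the `p j`. -/
def discreteCouplings {J : ℕ} {K : Fin J → ℕ} (p : (j : Fin J) → Fin (K j) → ℝ≥0) :
    Set (((j : Fin J) → Fin (K j)) → ℝ≥0) :=
  {w | ∀ (j : Fin J) (a : Fin (K j)), ∑ k with k j = a, w k = p j a}

/-- Objective of the discrete multi-marginal program, where `g j a` is the `a`-th component of the
`j`-th mixture. -/
def discreteCost {d J : ℕ} {K : Fin J → ℕ} (lam : Fin J → ℝ≥0)
    (g : (j : Fin J) → Fin (K j) → Measure (Rd d)) (w : ((j : Fin J) → Fin (K j)) → ℝ≥0) : ℝ≥0∞ :=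
  ∑ k, (w k : ℝ≥0∞) * mmW2sq lam (fun j => g j (k j))

/-- `w` solves the discrete multi-marginal program. -/
def IsOptimalDiscrete {d J : ℕ} {K : Fin J → ℕ} (lam : Fin J → ℝ≥0)
    (p : (j : Fin J) → Fin (K j) → ℝ≥0) (g : (j : Fin J) → Fin (K j) → Measure (Rd d))
    (w : ((j : Fin J) → Fin (K j)) → ℝ≥0) : Prop :=
  w ∈ discreteCouplings p ∧
    ∀ w' ∈ discreteCouplings p, discreteCost lam g w ≤ discreteCost lam g w'

end GMMOT

end

/-!
A plan that is a Gaussian mixture has marginals that are again Gaussian mixtures. Distinct Gaussian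
measures have linearly independent moment generating functions, since along a generic line these
are exponentials of distinct quadratic polynomials; hence the components and weights of a Gaussian
mixture are determined by the mixture, and a plan that competes for `MW₂²` between two mixtures is
at least as expensive as the discrete transport between their components with cost `W₂²`.

For nondegenerate Gaussians with covariance matrices `S j = Y j * (Y j)ᵀ`, the factors `Y j` can be
rotated so as to maximize the trace of `Aᵀ * A`, where `A = ∑ j, lam j • Y j`. Maximality under
reflections and products of two reflections makes `Aᵀ * Y j` positive definite when `0 < lam j`, so
the maps `Y j * A⁻¹` are then gradients of convex functions, and they average to the identity. They
are the optimal maps from the Gaussian with covariance `A * Aᵀ` to the given ones. Their quadratic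
Kantorovich potentials on the barycenter side sum to zero with the weights `lam`, which certifies
optimality, identifies the optimal value with `mmW₂²`, and yields uniqueness from the quadratic
remainder.

For a competitor `∑ l, q l • β l`, the optimal discrete plans from its components to those of the
`J` mixtures are glued along `l`. Replacing each `β l` by the barycenters of the tuples glued to it
cannot increase the cost, and keeps it only if nothing changes. Finally the admissible tensors are
the convex representations of the family `p` by the indicator vectors of multi-indices; these lie
in an affine space of dimension `∑ j, (K j - 1)`, so Carathéodory's theorem makes the support of an
optimal tensor small, and complementary slackness keeps it optimal.
-/

namespace GMMOT

section Identifiability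

open Filter Topology
open scoped RealInnerProductSpace

lemma tendsto_exp_quadratic_sub_of_lex_lt {q r : ℝ × ℝ} (h : toLex q < toLex r) :
    Tendsto (fun u : ℝ => Real.exp (q.1 * u ^ 2 / 2 + q.2 * u - (r.1 * u ^ 2 / 2 + r.2 * u)))
      atTop (𝓝 0) := by
  refine Real.tendsto_exp_atBot.comp ?_
  rcases Prod.Lex.toLex_lt_toLex.mp h with hlt | ⟨heq, hlt⟩
  · have hfactor : Tendsto (fun u : ℝ => u * ((q.2 - r.2) + (q.1 - r.1) / 2 * u)) atTop atBot :=
      tendsto_id.atTop_mul_atBot₀ <| tendsto_atBot_add_const_left _ _ <|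
        Tendsto.const_mul_atTop_of_neg (by linarith) tendsto_id
    exact hfactor.congr fun u => by ring
  · have hlin : Tendsto (fun u : ℝ => (q.2 - r.2) * u) atTop atBot :=
      Tendsto.const_mul_atTop_of_neg (by linarith) tendsto_id
    exact hlin.congr fun u => by rw [heq]; ring

lemma linearIndependent_exp_quadratic :
    LinearIndependent ℝ (fun (q : ℝ × ℝ) (u : ℝ) => Real.exp (q.1 * u ^ 2 / 2 + q.2 * u)) := by
  classical
  rw [linearIndependent_iff']
  intro s c hc
  by_contra! hne
  obtain ⟨i, hi, hci⟩ := hne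
  obtain ⟨r, hr, hmax⟩ := Finset.exists_max_image (s.filter (fun q => c q ≠ 0)) toLex
    ⟨i, by simp [hi, hci]⟩
  rw [Finset.mem_filter] at hr
  -- After division by the lexicographically dominant exponential only its own term survives.
  have hterm : ∀ q ∈ s, Tendsto (fun u : ℝ =>
      c q * Real.exp (q.1 * u ^ 2 / 2 + q.2 * u - (r.1 * u ^ 2 / 2 + r.2 * u))) atTop
      (𝓝 (if q = r then c r else 0)) := by
    intro q hq
    by_cases hqr : q = r
    · simp [hqr]
    by_cases hcq : c q = 0
    · simp [hqr, hcq]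
    have hlt : toLex q < toLex r :=
      (hmax q (by simp [hq, hcq])).lt_of_ne fun h => hqr (toLex.injective h)
    simpa [hqr] using (tendsto_exp_quadratic_sub_of_lex_lt hlt).const_mul (c q)
  have hzero : ∀ u : ℝ, ∑ q ∈ s,
      c q * Real.exp (q.1 * u ^ 2 / 2 + q.2 * u - (r.1 * u ^ 2 / 2 + r.2 * u)) = 0 := by
    intro u
    have hu : ∑ q ∈ s, c q * Real.exp (q.1 * u ^ 2 / 2 + q.2 * u) = 0 := by
      simpa using congrFun hc u
    simp only [Real.exp_sub, ← mul_div_assoc, ← Finset.sum_div, hu, zero_div]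
  have hlim := tendsto_finsetSum s hterm
  simp only [hzero, Finset.sum_ite_eq', hr.1, if_true] at hlim
  exact hr.2 (tendsto_nhds_unique hlim tendsto_const_nhds)

lemma sum_fiber_eq_of_linearIndependent {R M X ι κ : Type*} [Ring R] [AddCommGroup M] [Module R M]
    [Fintype ι] [Fintype κ] [DecidableEq X] {v : X → M} (hv : LinearIndependent R v)
    {r : ι → R} {f : ι → X} {p : κ → R} {g : κ → X}
    (h : ∑ i, r i • v (f i) = ∑ a, p a • v (g a)) (x : X) :
    ∑ i with f i = x, r i = ∑ a with g a = x, p a := by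
  have hsingle : ∑ i, Finsupp.single (f i) (r i) = ∑ a, Finsupp.single (g a) (p a) :=
    hv (by simpa using h)
  simpa [Finsupp.finsetSum_apply, Finsupp.single_apply, Finset.sum_filter]
    using DFunLike.congr_fun hsingle x

variable {E : Type*} [NormedAddCommGroup E] [InnerProductSpace ℝ E] [MeasurableSpace E]
  [BorelSpace E]

/-- Variance and mean of the image of `G` under `⟪t, ·⟫`; if `G` is Gaussian they determine this
image. -/
noncomputable def projectedMoments (G : Measure E) (t : E) : ℝ × ℝ :=
  (covarianceBilin G t t, ⟪t, ∫ x, x ∂G⟫)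

lemma analyticOnNhd_projectedMoments (G : Measure E) :
    AnalyticOnNhd ℝ (projectedMoments G) Set.univ := by
  refine AnalyticOnNhd.prod (fun t _ => ?_) fun t _ => ?_
  · exact ((covarianceBilin G).analyticAt_bilinear (t, t)).comp (f := fun t => (t, t)) (by fun_prop)
  · exact (innerSLFlip ℝ (∫ x, x ∂G)).analyticAt t

lemma isOpen_setOf_projectedMoments_ne (G H : Measure E) :
    IsOpen {t | projectedMoments G t ≠ projectedMoments H t} :=
  isOpen_ne_fun (analyticOnNhd_projectedMoments G).continuous
    (analyticOnNhd_projectedMoments H).continuous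

variable [FiniteDimensional ℝ E]

lemma eq_of_projectedMoments_eq {G H : Measure E} [IsGaussian G] [IsGaussian H]
    (h : projectedMoments G = projectedMoments H) : G = H := by
  refine Measure.ext_of_charFun (E := E) (funext fun t => ?_)
  obtain ⟨hvar, hmean⟩ := Prod.mk.inj (congrFun h t)
  simp only [IsGaussian.charFun_eq', id_eq, hvar, hmean]

lemma dense_setOf_projectedMoments_ne {G H : Measure E} [IsGaussian G] [IsGaussian H]
    (hne : G ≠ H) : Dense {t | projectedMoments G t ≠ projectedMoments H t} := by
  intro t
  by_contra ht
  rw [mem_closure_iff_frequently, not_frequently] at ht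
  have heq : projectedMoments G =ᶠ[𝓝 t] projectedMoments H :=
    ht.mono fun _ h => not_not.mp h
  exact hne <| eq_of_projectedMoments_eq <|
    (analyticOnNhd_projectedMoments G).eq_of_eventuallyEq (analyticOnNhd_projectedMoments H) heq

lemma exists_injOn_projectedMoments (s : Finset {G : Measure E // IsGaussian G}) :
    ∃ t : E, Set.InjOn (fun G : {G : Measure E // IsGaussian G} => projectedMoments G.1 t) s := by
  have hdense := dense_biInter_of_isOpen
    (f := fun q : {G : Measure E // IsGaussian G} × {G : Measure E // IsGaussian G} =>
      {t | projectedMoments q.1.1 t ≠ projectedMoments q.2.1 t})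
    (fun q _ => isOpen_setOf_projectedMoments_ne q.1.1 q.2.1)
    s.finite_toSet.offDiag.countable
    (fun q hq => by
      have := q.1.2
      have := q.2.2
      exact dense_setOf_projectedMoments_ne (Subtype.coe_ne_coe.mpr hq.2.2))
  obtain ⟨t, ht⟩ := hdense.nonempty
  rw [Set.mem_iInter₂] at ht
  exact ⟨t, fun G hG H hH heq => by_contra fun hne => ht (G, H) ⟨hG, hH, hne⟩ heq⟩

section GaussianMgf

variable (G : Measure E) [IsGaussian G] (t : E)

lemma map_inner_of_isGaussian :
    G.map (fun x => ⟪t, x⟫) =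
      gaussianReal (projectedMoments G t).2 (projectedMoments G t).1.toNNReal := by
  have h := IsGaussian.map_eq_gaussianReal (μ := G) (innerSL ℝ t)
  rw [IsGaussian.integral_dual] at h
  rw [projectedMoments, covarianceBilin_self IsGaussian.memLp_two_id]
  exact h

lemma integrable_exp_inner_of_isGaussian : Integrable (fun x => Real.exp ⟪t, x⟫) G := by
  have h := integrable_exp_mul_gaussianReal (μ := (projectedMoments G t).2)
    (v := (projectedMoments G t).1.toNNReal) 1
  rw [← map_inner_of_isGaussian] at h
  simpa only [Function.comp_def, one_mul] using h.comp_measurable (by fun_prop)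

lemma integral_exp_inner_smul_of_isGaussian (u : ℝ) :
    ∫ x, Real.exp ⟪u • t, x⟫ ∂G =
      Real.exp ((projectedMoments G t).1 * u ^ 2 / 2 + (projectedMoments G t).2 * u) := by
  have hvar : 0 ≤ (projectedMoments G t).1 := by
    rw [projectedMoments, covarianceBilin_self IsGaussian.memLp_two_id]
    exact variance_nonneg _ _
  have h := mgf_gaussianReal (map_inner_of_isGaussian G t) u
  rw [Real.coe_toNNReal _ hvar, add_comm] at h
  simpa only [mgf, real_inner_smul_left] using h

end GaussianMgf

lemma linearIndependent_integral_exp_inner :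
    LinearIndependent ℝ
      (fun (G : {G : Measure E // IsGaussian G}) (t : E) => ∫ x, Real.exp ⟪t, x⟫ ∂G.1) := by
  rw [linearIndependent_iff']
  intro s c hc G hG
  obtain ⟨t, ht⟩ := exists_injOn_projectedMoments s
  have hline := linearIndependent_exp_quadratic.comp
    (fun G : s => projectedMoments G.1.1 t) ht.injective
  refine Fintype.linearIndependent_iff.mp hline (fun G => c G.1) (funext fun u => ?_) ⟨G, hG⟩
  have hu := congrFun hc (u • t)
  rw [← Finset.sum_coe_sort] at hu
  simp only [Finset.sum_apply, Pi.smul_apply, Pi.zero_apply, Function.comp_apply] at hu ⊢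
  rw [← hu]
  refine Finset.sum_congr rfl fun G _ => ?_
  have := G.1.2
  rw [integral_exp_inner_smul_of_isGaussian]

lemma integral_exp_inner_gaussianMixture {ι : Type*} [Fintype ι] (r : ι → ℝ≥0)
    {α : ι → Measure E} (hα : ∀ i, IsGaussian (α i)) (t : E) :
    ∫ x, Real.exp ⟪t, x⟫ ∂(∑ i, r i • α i) = ∑ i, (r i : ℝ) • ∫ x, Real.exp ⟪t, x⟫ ∂α i := by
  rw [integral_finsetSum_measure fun i _ =>
    (integrable_exp_inner_of_isGaussian (α i) t).smul_measure_nnreal]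
  exact Finset.sum_congr rfl fun i _ => integral_smul_nnreal_measure _ _

theorem gaussianMixture_weights_eq {ι κ : Type*} [Fintype ι] [Fintype κ]
    {r : ι → ℝ≥0} {α : ι → Measure E} {p : κ → ℝ≥0} {g : κ → Measure E}
    (hα : ∀ i, IsGaussian (α i)) (hg : ∀ a, IsGaussian (g a))
    (h : ∑ i, r i • α i = ∑ a, p a • g a) [DecidableEq (Measure E)] (G : Measure E) :
    ∑ i with α i = G, r i = ∑ a with g a = G, p a := by
  by_cases hG : IsGaussian G
  swap
  · rw [Finset.filter_false_of_mem fun i _ (hi : α i = G) => hG (hi ▸ hα i),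
      Finset.filter_false_of_mem fun a _ (ha : g a = G) => hG (ha ▸ hg a), Finset.sum_empty,
      Finset.sum_empty]
  have hexp : ∑ i, (r i : ℝ) • (fun t : E => ∫ x, Real.exp ⟪t, x⟫ ∂α i) =
      ∑ a, (p a : ℝ) • (fun t : E => ∫ x, Real.exp ⟪t, x⟫ ∂g a) := by
    funext t
    have ht := integral_exp_inner_gaussianMixture r hα t
    rw [h, integral_exp_inner_gaussianMixture p hg t] at ht
    simpa only [Finset.sum_apply, Pi.smul_apply] using ht.symm
  have hfiber := sum_fiber_eq_of_linearIndependent linearIndependent_integral_exp_inner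
    (f := fun i => ⟨α i, hα i⟩) (g := fun a => ⟨g a, hg a⟩) hexp ⟨G, hG⟩
  simp only [Subtype.mk.injEq] at hfiber
  exact_mod_cast hfiber

end Identifiability

section Procrustes

open Matrix
open scoped MatrixOrder

variable {n : Type*} [Fintype n]

lemma dotProduct_self_pos {u : n → ℝ} (hu : u ≠ 0) : 0 < u ⬝ᵥ u := by
  simpa using dotProduct_star_self_pos_iff.mpr hu

section TraceMaximal

variable [DecidableEq n]

/-- The matrix of the orthogonal reflection in the hyperplane orthogonal to `u`. -/
noncomputable def householder (u : n → ℝ) : Matrix n n ℝ :=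
  1 - (2 / (u ⬝ᵥ u)) • vecMulVec u u

lemma householder_mem_orthogonalGroup {u : n → ℝ} (hu : u ≠ 0) :
    householder u ∈ orthogonalGroup n ℝ := by
  have huu : u ⬝ᵥ u ≠ 0 := (dotProduct_self_pos hu).ne'
  have hsymm : (householder u)ᵀ = householder u := by simp [householder, transpose_vecMulVec]
  have hsq : vecMulVec u u * vecMulVec u u = (u ⬝ᵥ u) • vecMulVec u u := by
    rw [vecMulVec_mul_vecMulVec, vecMulVec_smul]
  have hcoef : 2 / (u ⬝ᵥ u) * (2 / (u ⬝ᵥ u)) * (u ⬝ᵥ u) = 2 / (u ⬝ᵥ u) + 2 / (u ⬝ᵥ u) := by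
    field_simp
    ring
  rw [mem_orthogonalGroup_iff, hsymm, householder, sub_mul, mul_sub, mul_sub, smul_mul_smul_comm,
    hsq, smul_smul, hcoef, add_smul]
  simp only [mul_one, one_mul]
  abel

lemma trace_mul_householder (M : Matrix n n ℝ) (u : n → ℝ) :
    (M * householder u).trace = M.trace - 2 / (u ⬝ᵥ u) * (u ⬝ᵥ M *ᵥ u) := by
  rw [householder, mul_sub, mul_one, trace_sub, mul_smul_comm, trace_smul, mul_vecMulVec,
    trace_vecMulVec, dotProduct_comm u (M *ᵥ u), smul_eq_mul]

lemma trace_mul_householder_mul_householder (M : Matrix n n ℝ) (u v : n → ℝ) :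
    (M * (householder u * householder v)).trace =
      M.trace - 2 / (u ⬝ᵥ u) * (u ⬝ᵥ M *ᵥ u) - 2 / (v ⬝ᵥ v) * (v ⬝ᵥ M *ᵥ v) +
        2 / (u ⬝ᵥ u) * (2 / (v ⬝ᵥ v)) * (u ⬝ᵥ v) * (v ⬝ᵥ M *ᵥ u) := by
  have hv : v ⬝ᵥ (M * householder u) *ᵥ v =
      v ⬝ᵥ M *ᵥ v - 2 / (u ⬝ᵥ u) * ((u ⬝ᵥ v) * (v ⬝ᵥ M *ᵥ u)) := by
    rw [← mulVec_mulVec, householder, sub_mulVec, one_mulVec, smul_mulVec, vecMulVec_mulVec]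
    simp only [mulVec_sub, mulVec_smul, dotProduct_sub, dotProduct_smul, smul_eq_mul,
      op_smul_eq_smul]
  rw [← mul_assoc, trace_mul_householder, trace_mul_householder, hv]
  ring

variable {M : Matrix n n ℝ}

lemma dotProduct_mulVec_self_nonneg_of_trace_mul_orthogonal_le
    (h : ∀ V ∈ orthogonalGroup n ℝ, (M * V).trace ≤ M.trace) (u : n → ℝ) :
    0 ≤ u ⬝ᵥ M *ᵥ u := by
  rcases eq_or_ne u 0 with rfl | hu
  · simp
  have hpos : 0 < u ⬝ᵥ u := dotProduct_self_pos hu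
  have hreflect := h _ (householder_mem_orthogonalGroup hu)
  rw [trace_mul_householder, sub_le_self_iff] at hreflect
  exact nonneg_of_mul_nonneg_right hreflect (by positivity)

lemma two_mul_dotProduct_mul_le_of_trace_mul_orthogonal_le
    (h : ∀ V ∈ orthogonalGroup n ℝ, (M * V).trace ≤ M.trace) (u v : n → ℝ) :
    2 * (u ⬝ᵥ v) * (v ⬝ᵥ M *ᵥ u) ≤ (v ⬝ᵥ v) * (u ⬝ᵥ M *ᵥ u) + (u ⬝ᵥ u) * (v ⬝ᵥ M *ᵥ v) := by
  rcases eq_or_ne u 0 with rfl | hu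
  · simp
  rcases eq_or_ne v 0 with rfl | hv
  · simp
  have huu : 0 < u ⬝ᵥ u := dotProduct_self_pos hu
  have hvv : 0 < v ⬝ᵥ v := dotProduct_self_pos hv
  have hrotate := h _ (mul_mem (householder_mem_orthogonalGroup hu)
    (householder_mem_orthogonalGroup hv))
  rw [trace_mul_householder_mul_householder] at hrotate
  have hscaled := mul_le_mul_of_nonneg_left hrotate (mul_pos huu hvv).le
  field_simp at hscaled
  linarith

lemma dotProduct_mulVec_comm_of_trace_mul_orthogonal_le
    (h : ∀ V ∈ orthogonalGroup n ℝ, (M * V).trace ≤ M.trace) (u v : n → ℝ) :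
    u ⬝ᵥ M *ᵥ v = v ⬝ᵥ M *ᵥ u := by
  rcases eq_or_ne u 0 with rfl | hu
  · simp
  have huu : 0 < u ⬝ᵥ u := dotProduct_self_pos hu
  -- Rotations in the plane of `u` and `v` by a small angle: the first order term must vanish.
  have hquad : ∀ t : ℝ, 0 ≤
      ((v ⬝ᵥ v) * (u ⬝ᵥ M *ᵥ u) + (u ⬝ᵥ u) * (v ⬝ᵥ M *ᵥ v) - 2 * (u ⬝ᵥ v) * (v ⬝ᵥ M *ᵥ u)) *
        (t * t) + (u ⬝ᵥ u) * (u ⬝ᵥ M *ᵥ v - v ⬝ᵥ M *ᵥ u) * t + 0 := by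
    intro t
    have ht := two_mul_dotProduct_mul_le_of_trace_mul_orthogonal_le h u (u + t • v)
    simp only [mulVec_add, mulVec_smul, dotProduct_add, add_dotProduct, dotProduct_smul,
      smul_dotProduct, smul_eq_mul, dotProduct_comm v u] at ht
    linarith
  have hdiscrim := discrim_le_zero hquad
  rw [discrim, mul_zero, sub_zero] at hdiscrim
  have hlin := pow_eq_zero_iff two_ne_zero |>.mp (hdiscrim.antisymm (sq_nonneg _))
  exact sub_eq_zero.mp ((mul_eq_zero.mp hlin).resolve_left huu.ne')

lemma posSemidef_of_trace_mul_orthogonal_le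
    (h : ∀ V ∈ orthogonalGroup n ℝ, (M * V).trace ≤ M.trace) : M.PosSemidef := by
  refine .of_dotProduct_mulVec_nonneg ?_ fun u => by
    simpa using dotProduct_mulVec_self_nonneg_of_trace_mul_orthogonal_le h u
  ext i j
  simpa using dotProduct_mulVec_comm_of_trace_mul_orthogonal_le h (Pi.single j 1) (Pi.single i 1)

end TraceMaximal

variable {ι : Type*}

/-- The families of factors `Y j` of the covariance matrices `S j`, i.e. `S j = Y j * (Y j)ᵀ`. -/
def factorTuples (S : ι → Matrix n n ℝ) : Set (ι → Matrix n n ℝ) :=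
  {Y | ∀ j, Y j * (Y j)ᵀ = S j}

lemma sq_apply_le_of_mem_factorTuples {S Y : ι → Matrix n n ℝ} (hY : Y ∈ factorTuples S)
    (j : ι) (a b : n) : Y j a b ^ 2 ≤ S j a a := by
  rw [← hY j, mul_apply]
  simp only [transpose_apply, ← sq]
  exact Finset.single_le_sum (f := fun b => Y j a b ^ 2) (fun _ _ => sq_nonneg _)
    (Finset.mem_univ b)

lemma isCompact_factorTuples (S : ι → Matrix n n ℝ) : IsCompact (factorTuples S) := by
  have hbox : IsCompact (Set.pi Set.univ fun j => Set.pi Set.univ fun a => Set.pi Set.univ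
      fun _ => Set.Icc (-(S j a a + 1)) (S j a a + 1) : Set (ι → n → n → ℝ)) :=
    isCompact_univ_pi fun j => isCompact_univ_pi fun a => isCompact_univ_pi fun _ => isCompact_Icc
  refine hbox.of_isClosed_subset ?_ fun Y hY j _ a _ b _ => ?_
  · simp only [factorTuples, Set.ofPred_forall]
    exact isClosed_iInter fun j => isClosed_eq (by fun_prop) continuous_const
  · have hentry := sq_apply_le_of_mem_factorTuples hY j a b
    exact ⟨by nlinarith, by nlinarith⟩

lemma trace_transpose_add_mul_add (N Z : Matrix n n ℝ) :
    ((N + Z)ᵀ * (N + Z)).trace = (Nᵀ * N).trace + 2 * (Nᵀ * Z).trace + (Z * Zᵀ).trace := by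
  have hcross : (Zᵀ * N).trace = (Nᵀ * Z).trace := by
    rw [← trace_transpose, transpose_mul, transpose_transpose]
  simp only [transpose_add, add_mul, mul_add, trace_add, hcross, trace_mul_comm Zᵀ Z]
  ring

lemma sum_smul_update [Fintype ι] [DecidableEq ι] {R M : Type*} [Semiring R] [AddCommMonoid M]
    [Module R M] (lam : ι → R) (Y : ι → M) (j : ι) (Z : M) :
    ∑ i, lam i • Function.update Y j Z i = ∑ i ∈ Finset.univ.erase j, lam i • Y i + lam j • Z := by
  rw [← Finset.sum_erase_add _ _ (Finset.mem_univ j), Function.update_self]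
  congr 1
  exact Finset.sum_congr rfl fun i hi => by rw [Function.update_of_ne (Finset.ne_of_mem_erase hi)]

lemma factorTuples_nonempty {S : ι → Matrix n n ℝ} (hS : ∀ j, (S j).PosSemidef) :
    (factorTuples S).Nonempty := by
  classical
  refine ⟨fun j => CFC.sqrt (S j), fun j => ?_⟩
  have hsymm : (CFC.sqrt (S j))ᵀ = CFC.sqrt (S j) := by
    simpa [star_eq_conjTranspose] using (CFC.sqrt_nonneg (S j)).isSelfAdjoint.star_eq
  rw [hsymm, CFC.sqrt_mul_sqrt_self _ (hS j).nonneg]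

lemma mul_orthogonal_mul_transpose [DecidableEq n] (Y : Matrix n n ℝ) {V : Matrix n n ℝ}
    (hV : V ∈ orthogonalGroup n ℝ) : Y * V * (Y * V)ᵀ = Y * Yᵀ := by
  have hVV : V * Vᵀ = 1 := (mem_orthogonalGroup_iff n ℝ).mp hV
  rw [transpose_mul, mul_assoc, ← mul_assoc V, hVV, one_mul]

lemma update_mul_mem_factorTuples [DecidableEq n] [DecidableEq ι] {S Y : ι → Matrix n n ℝ}
    (hY : Y ∈ factorTuples S) (j : ι) {V : Matrix n n ℝ} (hV : V ∈ orthogonalGroup n ℝ) :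
    Function.update Y j (Y j * V) ∈ factorTuples S := by
  intro i
  rcases eq_or_ne i j with rfl | hij
  · rw [Function.update_self, mul_orthogonal_mul_transpose _ hV, hY i]
  · rw [Function.update_of_ne hij, hY i]

lemma posSemidef_sum_erase_transpose_mul_of_isMaxOn [Fintype ι] [DecidableEq ι] {lam : ι → ℝ}
    {S Y : ι → Matrix n n ℝ} (hY : Y ∈ factorTuples S)
    (hmax : IsMaxOn (fun Y => ((∑ i, lam i • Y i)ᵀ * ∑ i, lam i • Y i).trace) (factorTuples S) Y)
    {j : ι} (hj : 0 < lam j) :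
    ((∑ i ∈ Finset.univ.erase j, lam i • Y i)ᵀ * Y j).PosSemidef := by
  classical
  refine posSemidef_of_trace_mul_orthogonal_le fun V hV => ?_
  have hle := isMaxOn_iff.mp hmax _ (update_mul_mem_factorTuples hY j hV)
  rw [← Function.update_eq_self j Y] at hle
  simp only [Function.update_idem, Function.update_self, sum_smul_update] at hle
  simp only [trace_transpose_add_mul_add, transpose_smul, smul_mul_assoc, mul_smul_comm,
    trace_smul, smul_eq_mul, mul_orthogonal_mul_transpose _ hV] at hle
  rw [mul_assoc]
  exact le_of_mul_le_mul_left (by linarith) hj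

lemma posDef_transpose_mul_self_of_posDef_mul_transpose {Y : Matrix n n ℝ}
    (h : (Y * Yᵀ).PosDef) : (Yᵀ * Y).PosDef := by
  classical
  have hunit : IsUnit Y := by
    have hdet := (isUnit_iff_isUnit_det _).mp h.isUnit
    rw [det_mul] at hdet
    exact (isUnit_iff_isUnit_det _).mpr (isUnit_of_mul_isUnit_left hdet)
  simpa using PosDef.one (n := n) (R := ℝ) |>.conjTranspose_mul_mul_same
    (mulVec_injective_iff_isUnit.mpr hunit)

theorem exists_aligned_factors [Fintype ι] (lam : ι → ℝ) {S : ι → Matrix n n ℝ}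
    (hS : ∀ j, (S j).PosDef) :
    ∃ Y ∈ factorTuples S, ∀ j, 0 < lam j → ((∑ i, lam i • Y i)ᵀ * Y j).PosDef := by
  classical
  obtain ⟨Y, hY, hmax⟩ := (isCompact_factorTuples S).exists_isMaxOn
    (factorTuples_nonempty fun j => (hS j).posSemidef)
    (f := fun Y => ((∑ i, lam i • Y i)ᵀ * ∑ i, lam i • Y i).trace)
    (Continuous.matrix_trace (by fun_prop)).continuousOn
  refine ⟨Y, hY, fun j hj => ?_⟩
  rw [← Finset.sum_erase_add _ _ (Finset.mem_univ j), transpose_add, add_mul, transpose_smul,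
    smul_mul_assoc]
  exact PosDef.posSemidef_add (posSemidef_sum_erase_transpose_mul_of_isMaxOn hY hmax hj)
    ((posDef_transpose_mul_self_of_posDef_mul_transpose (by rw [hY j]; exact hS j)).smul hj)

end Procrustes

section GaussianTransport

open Matrix
open scoped RealInnerProductSpace MatrixOrder

variable {ι : Type*} [Fintype ι] [DecidableEq ι]

lemma map_stdGaussian_add_toEuclideanCLM (m : EuclideanSpace ℝ ι) (Y : Matrix ι ι ℝ) :
    (stdGaussian (EuclideanSpace ℝ ι)).map (fun x => m + toEuclideanCLM (𝕜 := ℝ) Y x) =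
      multivariateGaussian m (Y * Yᵀ) := by
  have hmap : (stdGaussian (EuclideanSpace ℝ ι)).map (fun x => m + toEuclideanCLM (𝕜 := ℝ) Y x) =
      ((stdGaussian (EuclideanSpace ℝ ι)).map (toEuclideanCLM (𝕜 := ℝ) Y)).map (fun x => m + x) :=
    (Measure.map_map (measurable_const_add m) (by fun_prop)).symm
  have hG : IsGaussian
      ((stdGaussian (EuclideanSpace ℝ ι)).map (fun x => m + toEuclideanCLM (𝕜 := ℝ) Y x)) := by
    rw [hmap]; infer_instance
  apply IsGaussian.ext
  · simp only [id_eq, integral_id_multivariateGaussian]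
    rw [integral_map (by fun_prop) (by fun_prop), integral_add (integrable_const _), integral_const]
    · simp [ContinuousLinearMap.integral_comp_comm _ IsGaussian.integrable_fun_id]
    · exact IsGaussian.integrable_id.comp_measurable (by fun_prop)
  · ext x y
    have hpsd : (Y * Yᵀ).PosSemidef := by simpa using posSemidef_self_mul_conjTranspose Y
    rw [covarianceBilin_multivariateGaussian hpsd, hmap, covarianceBilin_map_const_add,
      covarianceBilin_map IsGaussian.memLp_two_id, covarianceBilin_stdGaussian,
      innerSL_apply_apply, ContinuousLinearMap.adjoint_inner_left,
      ← ContinuousLinearMap.star_eq_adjoint, ← map_star, ← ContinuousLinearMap.comp_apply,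
      ← ContinuousLinearMap.mul_def, ← map_mul, star_eq_conjTranspose,
      conjTranspose_eq_transpose_of_trivial, inner_toEuclideanCLM]

lemma isUnit_det_of_posDef_transpose_mul {A Y : Matrix ι ι ℝ} (h : (Aᵀ * Y).PosDef) :
    IsUnit A.det := by
  have hdet := (isUnit_iff_isUnit_det _).mp h.isUnit
  rw [det_mul, det_transpose] at hdet
  exact isUnit_of_mul_isUnit_left hdet

lemma posDef_mul_inv_of_posDef_transpose_mul {A Y : Matrix ι ι ℝ} (h : (Aᵀ * Y).PosDef) :
    (Y * A⁻¹).PosDef := by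
  have hdet := isUnit_det_of_posDef_transpose_mul h
  have hconj := h.conjTranspose_mul_mul_same (B := A⁻¹) (mulVec_injective_iff_isUnit.mpr
    (isUnit_nonsing_inv_iff.mpr ((isUnit_iff_isUnit_det _).mpr hdet)))
  rwa [conjTranspose_eq_transpose_of_trivial, ← mul_assoc, ← transpose_mul,
    mul_nonsing_inv _ hdet, transpose_one, one_mul] at hconj

lemma exists_inner_toEuclideanCLM_eq_inner {P : Matrix ι ι ℝ} (hP : P.PosDef) :
    ∃ B : EuclideanSpace ℝ ι →L[ℝ] EuclideanSpace ℝ ι,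
      ∀ x y, ⟪B x, B (toEuclideanCLM (𝕜 := ℝ) P y)⟫ = ⟪x, y⟫ := by
  refine ⟨toEuclideanCLM (𝕜 := ℝ) (CFC.sqrt P⁻¹), fun x y => ?_⟩
  have hstar : star (CFC.sqrt P⁻¹) = CFC.sqrt P⁻¹ := (CFC.sqrt_nonneg _).isSelfAdjoint.star_eq
  have hsqrt : CFC.sqrt P⁻¹ * CFC.sqrt P⁻¹ * P = 1 := by
    rw [CFC.sqrt_mul_sqrt_self _ hP.inv.posSemidef.nonneg,
      nonsing_inv_mul _ ((isUnit_iff_isUnit_det _).mp hP.isUnit)]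
  rw [← ContinuousLinearMap.adjoint_inner_right, ← ContinuousLinearMap.star_eq_adjoint,
    ← map_star, hstar, ← ContinuousLinearMap.comp_apply, ← ContinuousLinearMap.comp_apply,
    ← ContinuousLinearMap.mul_def, ← ContinuousLinearMap.mul_def, ← map_mul, ← map_mul,
    hsqrt, map_one, one_apply_eq_self]

end GaussianTransport

section BarycentricMaps

open scoped RealInnerProductSpace

variable {d J : ℕ} {lam : Fin J → ℝ≥0} {g : Fin J → Measure (Rd d)} {ν : Measure (Rd d)}

/-- A certificate that `ν` is the `W₂` barycenter of the `g j`: affine maps `z ↦ T j z + b j`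
which carry `ν` to the `g j`, average to the identity, and are gradients of convex functions. The
latter is encoded by a factorization `(B j)ᵀ * B j` of the inverse of `T j`. -/
structure BarycentricMaps (lam : Fin J → ℝ≥0) (g : Fin J → Measure (Rd d))
    (ν : Measure (Rd d)) where
  T : Fin J → Rd d →L[ℝ] Rd d
  B : Fin J → Rd d →L[ℝ] Rd d
  b : Fin J → Rd d
  sum_smul_eq : ∀ z, ∑ j, (lam j : ℝ) • (T j z + b j) = z
  map_eq : ∀ j, ν.map (fun z => T j z + b j) = g j
  inner_eq : ∀ j, 0 < lam j → ∀ x y, ⟪B j x, B j (T j y)⟫ = ⟪x, y⟫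

open Matrix in
theorem exists_barycentricMaps (hlam : ∑ j, lam j = 1) (m : Fin J → Rd d)
    {S : Fin J → Matrix (Fin d) (Fin d) ℝ} (hS : ∀ j, (S j).PosDef)
    (hg : ∀ j, g j = multivariateGaussian (m j) (S j)) :
    ∃ ν, IsGaussian ν ∧ Nonempty (BarycentricMaps lam g ν) := by
  obtain ⟨Y, hYS, hpd⟩ := exists_aligned_factors (fun j => (lam j : ℝ)) hS
  obtain ⟨i, -, hi⟩ := Finset.exists_ne_zero_of_sum_ne_zero (hlam.trans_ne one_ne_zero)
  set A := ∑ j, (lam j : ℝ) • Y j with hA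
  set mbar := ∑ j, (lam j : ℝ) • m j with hmbar
  have hdet : IsUnit A.det := isUnit_det_of_posDef_transpose_mul (hpd i (by positivity))
  have hB : ∀ j, 0 < lam j → ∃ B : Rd d →L[ℝ] Rd d,
      ∀ x y, ⟪B x, B (toEuclideanCLM (𝕜 := ℝ) (Y j * A⁻¹) y)⟫ = ⟪x, y⟫ := fun j hj =>
    exists_inner_toEuclideanCLM_eq_inner (posDef_mul_inv_of_posDef_transpose_mul (hpd j hj))
  choose! B hB using hB
  have hsum : ∀ z, ∑ j, (lam j : ℝ) • toEuclideanCLM (𝕜 := ℝ) (Y j * A⁻¹) z = z := by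
    intro z
    have h : ∑ j, (lam j : ℝ) • toEuclideanCLM (n := Fin d) (𝕜 := ℝ) (Y j * A⁻¹) = 1 := by
      simp_rw [← map_smul, ← map_sum, ← smul_mul_assoc, ← Finset.sum_mul, ← hA,
        mul_nonsing_inv _ hdet, map_one]
    simpa using congrArg (fun f => f z) h
  refine ⟨(stdGaussian (Rd d)).map (fun x => mbar + toEuclideanCLM (𝕜 := ℝ) A x), ?_,
    ⟨⟨fun j => toEuclideanCLM (𝕜 := ℝ) (Y j * A⁻¹), B,
      fun j => m j - toEuclideanCLM (𝕜 := ℝ) (Y j * A⁻¹) mbar, fun z => ?_, fun j => ?_, hB⟩⟩⟩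
  · rw [map_stdGaussian_add_toEuclideanCLM]
    infer_instance
  · simp only [smul_add, smul_sub, Finset.sum_add_distrib, Finset.sum_sub_distrib, hsum]
    rw [← hmbar, sub_self, add_zero]
  · rw [Measure.map_map (by fun_prop) (by fun_prop), hg j, ← hYS j,
      ← map_stdGaussian_add_toEuclideanCLM]
    congr 1
    funext x
    have hTA : toEuclideanCLM (𝕜 := ℝ) (Y j * A⁻¹) (toEuclideanCLM (𝕜 := ℝ) A x) =
        toEuclideanCLM (𝕜 := ℝ) (Y j) x := by
      rw [← ContinuousLinearMap.comp_apply, ← ContinuousLinearMap.mul_def, ← map_mul, mul_assoc,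
        nonsing_inv_mul _ hdet, mul_one]
    rw [Function.comp_apply, map_add, hTA]
    abel

end BarycentricMaps

section SecondMoments

variable {d : ℕ} {α E : Type*} [MeasurableSpace α] [NormedAddCommGroup E] {η : Measure α}

lemma lintegral_enorm_sq_eq_ofReal {f : α → E} (hf : MemLp f 2 η) :
    ∫⁻ x, ‖f x‖ₑ ^ 2 ∂η = ENNReal.ofReal (∫ x, ‖f x‖ ^ 2 ∂η) := by
  rw [ofReal_integral_eq_lintegral_ofReal (hf.integrable_norm_pow two_ne_zero)
    (ae_of_all _ fun x => by positivity)]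
  simp only [ENNReal.ofReal_pow (norm_nonneg _), ofReal_norm]

lemma lintegral_enorm_sq_ne_top {f : α → E} (hf : MemLp f 2 η) :
    ∫⁻ x, ‖f x‖ₑ ^ 2 ∂η ≠ ∞ :=
  lintegral_enorm_sq_eq_ofReal hf ▸ ENNReal.ofReal_ne_top

lemma memLp_two_id_of_mem_P2 {ρ : Measure (Rd d)} (h : ρ ∈ P2 d) : MemLp id 2 ρ := by
  rw [memLp_two_iff_integrable_sq_norm aestronglyMeasurable_id]
  refine ⟨by fun_prop, ?_⟩
  rw [hasFiniteIntegral_iff_enorm]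
  simpa only [id_eq, enorm_pow, enorm_norm] using h.2

lemma mem_P2_of_isGaussian (ρ : Measure (Rd d)) [IsGaussian ρ] : ρ ∈ P2 d :=
  ⟨inferInstance, (lintegral_enorm_sq_ne_top (IsGaussian.memLp_two_id (μ := ρ))).lt_top⟩

lemma map_mem_P2 [IsProbabilityMeasure η] {f : α → Rd d} (hf : Measurable f)
    (h : MemLp f 2 η) : η.map f ∈ P2 d := by
  refine ⟨Measure.isProbabilityMeasure_map hf.aemeasurable, ?_⟩
  rw [lintegral_map (by fun_prop) hf]
  exact (lintegral_enorm_sq_ne_top h).lt_top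

end SecondMoments

section Couplings

variable {d : ℕ} {μ ρ : Measure (Rd d)} {γ : Measure (Rd d × Rd d)}

lemma memLp_fst_of_mem_couplings (hγ : γ ∈ couplings μ ρ) (hμ : μ ∈ P2 d) :
    MemLp (fun y : Rd d × Rd d => y.1) 2 γ :=
  (memLp_two_id_of_mem_P2 hμ).comp_measurePreserving ⟨measurable_fst, hγ.2.1⟩

lemma memLp_snd_of_mem_couplings (hγ : γ ∈ couplings μ ρ) (hρ : ρ ∈ P2 d) :
    MemLp (fun y : Rd d × Rd d => y.2) 2 γ :=
  (memLp_two_id_of_mem_P2 hρ).comp_measurePreserving ⟨measurable_snd, hγ.2.2⟩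

lemma map_prodMap_mem_couplings (hγ : γ ∈ couplings μ ρ) {f h : Rd d → Rd d} (hf : Measurable f)
    (hh : Measurable h) : γ.map (Prod.map f h) ∈ couplings (μ.map f) (ρ.map h) := by
  have := hγ.1
  refine ⟨Measure.isProbabilityMeasure_map (by fun_prop), ?_, ?_⟩
  · rw [← hγ.2.1, Measure.map_map (by fun_prop) (by fun_prop),
      Measure.map_map (by fun_prop) (by fun_prop), Prod.map_fst']
  · rw [← hγ.2.2, Measure.map_map (by fun_prop) (by fun_prop),
      Measure.map_map (by fun_prop) (by fun_prop), Prod.map_snd']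

lemma integral_fst_add_snd_of_mem_couplings (hγ : γ ∈ couplings μ ρ)
    {φ ψ : Rd d → ℝ} (hφ : Integrable φ μ) (hψ : Integrable ψ ρ) :
    Integrable (fun y => φ y.1 + ψ y.2) γ ∧
      ∫ y, φ y.1 + ψ y.2 ∂γ = ∫ x, φ x ∂μ + ∫ y, ψ y ∂ρ := by
  obtain ⟨-, rfl, rfl⟩ := hγ
  have hφ' := hφ.comp_measurable measurable_fst
  have hψ' := hψ.comp_measurable measurable_snd
  refine ⟨hφ'.add hψ', ?_⟩
  rw [integral_map measurable_fst.aemeasurable hφ.1, integral_map measurable_snd.aemeasurable hψ.1]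
  exact integral_add hφ' hψ'

lemma W2sq_ne_top (hμ : μ ∈ P2 d) (hρ : ρ ∈ P2 d) : W2sq μ ρ ≠ ∞ := by
  have := hμ.1
  have := hρ.1
  have hprod : μ.prod ρ ∈ couplings μ ρ := ⟨inferInstance, by simp, by simp⟩
  exact ne_top_of_le_ne_top (lintegral_enorm_sq_ne_top
    ((memLp_fst_of_mem_couplings hprod hμ).sub (memLp_snd_of_mem_couplings hprod hρ)))
    (iInf₂_le _ hprod)

lemma exists_mem_couplings_lintegral_lt {c : ℝ≥0∞} (h : W2sq μ ρ < c) :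
    ∃ γ ∈ couplings μ ρ, ∫⁻ y, ‖y.1 - y.2‖ₑ ^ 2 ∂γ < c := by
  simpa only [W2sq, iInf_lt_iff, exists_prop] using h

lemma measure_le_measure_thickening_add_of_mem_couplings (hγ : γ ∈ couplings μ ρ) {s : Set (Rd d)}
    (hs : MeasurableSet s) {ε : ℝ≥0∞} (hε : 0 < ε) (hε' : ε < ∞) :
    μ s ≤ ρ (Metric.thickening ε.toReal s) + (∫⁻ y, ‖y.1 - y.2‖ₑ ^ 2 ∂γ) / ε ^ 2 := by
  have hsub : Prod.fst ⁻¹' s ⊆ Prod.snd ⁻¹' Metric.thickening ε.toReal s ∪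
      {y : Rd d × Rd d | ε ^ 2 ≤ ‖y.1 - y.2‖ₑ ^ 2} := by
    intro y hy
    by_contra! h
    simp only [Set.mem_union, Set.mem_preimage, Set.mem_ofPred_eq, not_or, not_le] at h
    refine h.1 (Metric.mem_thickening_iff.mpr ⟨y.1, hy, ?_⟩)
    rw [dist_comm, dist_eq_norm, ← toReal_enorm]
    exact (ENNReal.toReal_lt_toReal enorm_ne_top hε'.ne).mpr (lt_of_pow_lt_pow_left' 2 h.2)
  calc μ s = γ (Prod.fst ⁻¹' s) := by rw [← hγ.2.1, Measure.map_apply measurable_fst hs]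
    _ ≤ γ (Prod.snd ⁻¹' Metric.thickening ε.toReal s) + γ {y | ε ^ 2 ≤ ‖y.1 - y.2‖ₑ ^ 2} :=
      (measure_mono hsub).trans (measure_union_le _ _)
    _ ≤ ρ (Metric.thickening ε.toReal s) + (∫⁻ y, ‖y.1 - y.2‖ₑ ^ 2 ∂γ) / ε ^ 2 := by
      rw [← hγ.2.2, Measure.map_apply measurable_snd Metric.isOpen_thickening.measurableSet]
      gcongr
      exact meas_ge_le_lintegral_div (by fun_prop) (by positivity) (by finiteness)

lemma eq_of_W2sq_eq_zero [IsProbabilityMeasure μ] [IsProbabilityMeasure ρ] (h : W2sq μ ρ = 0) :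
    μ = ρ := by
  have hdist : levyProkhorovEDist μ ρ = 0 := by
    refine nonpos_iff_eq_zero.mp (levyProkhorovEDist_le_of_forall_le μ ρ 0
      fun ε s hε hε' hs => ?_)
    obtain ⟨γ, hγ, hlt⟩ := exists_mem_couplings_lintegral_lt
      (show W2sq μ ρ < ε * ε ^ 2 by rw [h]; positivity)
    refine (measure_le_measure_thickening_add_of_mem_couplings hγ hs hε hε').trans ?_
    gcongr
    exact ENNReal.div_le_of_le_mul hlt.le
  refine ext_of_generate_finite _
    ((BorelSpace.measurable_eq (α := Rd d)).trans borel_eq_generateFrom_isClosed)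
    isPiSystem_isClosed (fun s hs => ?_) (by simp only [measure_univ])
  exact measure_eq_measure_of_levyProkhorovEDist_eq_zero_of_isClosed hdist hs
    ⟨1, one_pos, by finiteness⟩ ⟨1, one_pos, by finiteness⟩

end Couplings

section MultiMarginal

open scoped RealInnerProductSpace

variable {d J : ℕ}

lemma half_sum_sum_sq_norm_sub {ι E : Type*} [Fintype ι] [NormedAddCommGroup E]
    [InnerProductSpace ℝ E] (lam : ι → ℝ) (hlam : ∑ j, lam j = 1) (y : ι → E) :
    1 / 2 * ∑ i, ∑ j, lam i * lam j * ‖y i - y j‖ ^ 2 =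
      ∑ j, lam j * ‖y j - ∑ i, lam i • y i‖ ^ 2 := by
  set ybar := ∑ i, lam i • y i with hybar
  have hinner : ∀ x, ∑ j, lam j * ⟪x, y j⟫ = ⟪x, ybar⟫ := fun x => by
    simp_rw [hybar, inner_sum, real_inner_smul_right]
  have hpair : ∀ i, ∑ j, lam i * lam j * ‖y i - y j‖ ^ 2 =
      lam i * ‖y i‖ ^ 2 - 2 * (lam i * ⟪ybar, y i⟫) + lam i * ∑ j, lam j * ‖y j‖ ^ 2 := by
    intro i
    rw [real_inner_comm, ← hinner, ← one_mul (lam i * ‖y i‖ ^ 2), ← hlam]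
    simp only [Finset.mul_sum, Finset.sum_mul, ← Finset.sum_add_distrib, ← Finset.sum_sub_distrib]
    refine Finset.sum_congr rfl fun j _ => ?_
    rw [norm_sub_sq_real]
    ring
  have hbar : ∀ j, lam j * ‖y j - ybar‖ ^ 2 =
      lam j * ‖y j‖ ^ 2 - 2 * (lam j * ⟪ybar, y j⟫) + lam j * ‖ybar‖ ^ 2 := fun j => by
    rw [norm_sub_sq_real, real_inner_comm]
    ring
  simp_rw [hpair, hbar, Finset.sum_add_distrib, Finset.sum_sub_distrib, ← Finset.mul_sum,
    ← Finset.sum_mul, hlam, hinner, real_inner_self_eq_norm_sq]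
  ring

lemma half_sum_sum_enorm_sq_sub {lam : Fin J → ℝ≥0} (hlam : ∑ j, lam j = 1) (y : Fin J → Rd d) :
    (1 / 2 : ℝ≥0∞) * ∑ i, ∑ j, (lam i : ℝ≥0∞) * (lam j : ℝ≥0∞) * ‖y i - y j‖ₑ ^ 2 =
      ∑ j, (lam j : ℝ≥0∞) * ‖y j - ∑ i, (lam i : ℝ) • y i‖ₑ ^ 2 := by
  have h := half_sum_sum_sq_norm_sub (fun j => (lam j : ℝ)) (by exact_mod_cast hlam) y
  have hnn : 1 / 2 * ∑ i, ∑ j, lam i * lam j * ‖y i - y j‖₊ ^ 2 =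
      ∑ j, lam j * ‖y j - ∑ i, (lam i : ℝ) • y i‖₊ ^ 2 := by
    rw [← NNReal.coe_inj]
    push_cast
    exact h
  have hcoe := congrArg ((↑) : ℝ≥0 → ℝ≥0∞) hnn
  push_cast [ENNReal.coe_div two_ne_zero] at hcoe
  exact hcoe

lemma exists_sum_W2sq_le_multiCost {lam : Fin J → ℝ≥0} (hlam : ∑ j, lam j = 1)
    {g : Fin J → Measure (Rd d)} (hg : ∀ j, g j ∈ P2 d) {η : Measure (Fin J → Rd d)}
    (hη : η ∈ multiCouplings g) :
    ∃ ρ ∈ P2 d, ∑ j, (lam j : ℝ≥0∞) * W2sq (g j) ρ ≤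
      ∫⁻ y, (1 / 2) * ∑ i, ∑ j, (lam i : ℝ≥0∞) * (lam j : ℝ≥0∞) * ‖y i - y j‖ₑ ^ 2 ∂η := by
  have := hη.1
  set bar : (Fin J → Rd d) → Rd d := fun y => ∑ i, (lam i : ℝ) • y i
  have hmeas : Measurable bar := by fun_prop
  have hL : ∀ j, MemLp (fun y : Fin J → Rd d => y j) 2 η := fun j =>
    (memLp_two_id_of_mem_P2 (hg j)).comp_measurePreserving ⟨by fun_prop, hη.2 j⟩
  refine ⟨η.map bar,
    map_mem_P2 hmeas (memLp_finsetSum _ fun i _ => (hL i).const_smul (lam i : ℝ)), ?_⟩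
  have hplan : ∀ j, η.map (fun y => (y j, bar y)) ∈ couplings (g j) (η.map bar) := fun j =>
    ⟨Measure.isProbabilityMeasure_map (by fun_prop),
      by rw [Measure.map_map (by fun_prop) (by fun_prop), ← hη.2 j]; rfl,
      by rw [Measure.map_map (by fun_prop) (by fun_prop)]; rfl⟩
  calc ∑ j, (lam j : ℝ≥0∞) * W2sq (g j) (η.map bar)
      ≤ ∑ j, (lam j : ℝ≥0∞) * ∫⁻ y, ‖y j - bar y‖ₑ ^ 2 ∂η := by
        gcongr with j
        refine (iInf₂_le _ (hplan j)).trans_eq ?_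
        rw [lintegral_map (by fun_prop) (by fun_prop)]
    _ = _ := by
        simp_rw [half_sum_sum_enorm_sq_sub hlam]
        rw [lintegral_finsetSum _ fun j _ => by fun_prop]
        exact Finset.sum_congr rfl fun j _ => (lintegral_const_mul _ (by fun_prop)).symm

end MultiMarginal

namespace BarycentricMaps

open scoped RealInnerProductSpace

variable {d J : ℕ} {lam : Fin J → ℝ≥0} {g : Fin J → Measure (Rd d)} {ν ρ : Measure (Rd d)}
  {γ : Measure (Rd d × Rd d)}

/-- The affine map `z ↦ T j z + b j`, which is the optimal transport map from `ν` to `g j`. -/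
noncomputable def transport (c : BarycentricMaps lam g ν) (j : Fin J) (z : Rd d) : Rd d :=
  c.T j z + c.b j

/-- The optimal transport plan between `g j` and `ν`. -/
noncomputable def plan (c : BarycentricMaps lam g ν) (j : Fin J) : Measure (Rd d × Rd d) :=
  ν.map fun z => (c.transport j z, z)

/-- The barycentric cost `∑ j, lam j * W₂²(g j, ν)`, computed with the optimal plans. -/
noncomputable def cost (c : BarycentricMaps lam g ν) : ℝ≥0∞ :=
  ∑ j, (lam j : ℝ≥0∞) * ∫⁻ y, ‖y.1 - y.2‖ₑ ^ 2 ∂c.plan j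

/-- The Kantorovich potential of the `j`-th transport problem on the side of `g j`. -/
noncomputable def fstPotential (c : BarycentricMaps lam g ν) (j : Fin J) (x : Rd d) : ℝ :=
  ‖x‖ ^ 2 - ‖c.B j (x - c.b j)‖ ^ 2

/-- The Kantorovich potential of the `j`-th transport problem on the side of `ν`. -/
noncomputable def sndPotential (c : BarycentricMaps lam g ν) (j : Fin J) (y : Rd d) : ℝ :=
  ‖y‖ ^ 2 - ⟪y, c.T j y⟫ - 2 * ⟪y, c.b j⟫

variable (c : BarycentricMaps lam g ν)

@[fun_prop]
lemma continuous_transport (j : Fin J) : Continuous (c.transport j) := by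
  unfold transport
  fun_prop

@[fun_prop]
lemma measurable_transport (j : Fin J) : Measurable (c.transport j) :=
  (c.continuous_transport j).measurable

lemma map_transport (j : Fin J) : ν.map (c.transport j) = g j :=
  c.map_eq j

lemma memLp_transport (hρ : ρ ∈ P2 d) (j : Fin J) : MemLp (c.transport j) 2 ρ :=
  have := hρ.1
  ((c.T j).comp_memLp' (memLp_two_id_of_mem_P2 hρ)).add (memLp_const (c.b j))

include c in
lemma mem_P2 (hν : ν ∈ P2 d) (j : Fin J) : g j ∈ P2 d :=
  have := hν.1
  c.map_transport j ▸ map_mem_P2 (c.measurable_transport j) (c.memLp_transport hν j)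

lemma sum_smul_transport (z : Rd d) : ∑ j, (lam j : ℝ) • c.transport j z = z :=
  c.sum_smul_eq z

lemma plan_mem_couplings [IsProbabilityMeasure ν] (j : Fin J) :
    c.plan j ∈ couplings (g j) ν := by
  unfold plan
  refine ⟨Measure.isProbabilityMeasure_map (by fun_prop), ?_, ?_⟩
  · rw [Measure.map_map (by fun_prop) (by fun_prop), ← c.map_transport j]
    rfl
  · rw [Measure.map_map (by fun_prop) (by fun_prop)]
    exact Measure.map_id

lemma isGaussian_plan [IsGaussian ν] (j : Fin J) : IsGaussian (c.plan j) := by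
  have hcomp : (fun z => (c.transport j z, z)) = (fun q : Rd d × Rd d => q + (c.b j, 0)) ∘
      ((c.T j).prod (ContinuousLinearMap.id ℝ (Rd d))) := by
    funext z
    simp [transport]
  rw [plan, hcomp, ← Measure.map_map (by fun_prop) (by fun_prop)]
  infer_instance

lemma integrable_fstPotential (hρ : ρ ∈ P2 d) (j : Fin J) :
    Integrable (c.fstPotential j) ρ := by
  have := hρ.1
  have hid := memLp_two_id_of_mem_P2 hρ
  exact (hid.integrable_norm_pow two_ne_zero).sub
    (((c.B j).comp_memLp' (hid.sub (memLp_const (c.b j)))).integrable_norm_pow two_ne_zero)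

lemma integrable_sndPotential (hρ : ρ ∈ P2 d) (j : Fin J) :
    Integrable (c.sndPotential j) ρ := by
  have := hρ.1
  have hid := memLp_two_id_of_mem_P2 hρ
  have hinner : ∀ {f : Rd d → Rd d}, MemLp f 2 ρ → Integrable (fun y => ⟪y, f y⟫) ρ := fun hf =>
    memLp_one_iff_integrable.mp ((innerSL ℝ).memLp_of_bilin 1 hid hf)
  exact ((hid.integrable_norm_pow two_ne_zero).sub (hinner ((c.T j).comp_memLp' hid))).sub
    ((hinner (memLp_const (c.b j))).const_mul 2)

lemma sq_norm_sub_eq_potentials {j : Fin J} (hj : 0 < lam j) (x y : Rd d) :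
    ‖x - y‖ ^ 2 = c.fstPotential j x + c.sndPotential j y +
      ‖c.B j (x - c.transport j y)‖ ^ 2 := by
  have hx : x - c.transport j y = (x - c.b j) - c.T j y := by unfold transport; abel
  have hT : ‖c.B j (c.T j y)‖ ^ 2 = ⟪y, c.T j y⟫ := by
    rw [← real_inner_self_eq_norm_sq, c.inner_eq j hj, real_inner_comm]
  unfold fstPotential sndPotential
  rw [hx, map_sub _ (x - c.b j), norm_sub_sq_real (c.B j (x - c.b j)), c.inner_eq j hj, hT,
    norm_sub_sq_real, inner_sub_left, real_inner_comm y (c.b j)]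
  ring

lemma sum_mul_sndPotential (hlam : ∑ j, lam j = 1) (y : Rd d) :
    ∑ j, (lam j : ℝ) * c.sndPotential j y = 0 := by
  have hb : ∑ j, (lam j : ℝ) • c.b j = 0 := by simpa using c.sum_smul_eq 0
  have hT : ∑ j, (lam j : ℝ) • c.T j y = y := by
    simpa only [smul_add, Finset.sum_add_distrib, hb, add_zero] using c.sum_smul_eq y
  have hlam' : ∑ j, (lam j : ℝ) = 1 := by exact_mod_cast hlam
  calc ∑ j, (lam j : ℝ) * c.sndPotential j y
      = (∑ j, (lam j : ℝ)) * ‖y‖ ^ 2 - ⟪y, ∑ j, (lam j : ℝ) • c.T j y⟫ -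
          2 * ⟪y, ∑ j, (lam j : ℝ) • c.b j⟫ := by
        simp only [sndPotential, inner_sum, real_inner_smul_right, Finset.sum_mul, Finset.mul_sum,
          ← Finset.sum_sub_distrib]
        exact Finset.sum_congr rfl fun j _ => by ring
    _ = 0 := by
        rw [hlam', hT, hb, inner_zero_right, real_inner_self_eq_norm_sq]
        ring

lemma memLp_gap (hν : ν ∈ P2 d) (hρ : ρ ∈ P2 d) {j : Fin J} (hγ : γ ∈ couplings (g j) ρ) :
    MemLp (fun y : Rd d × Rd d => c.B j (y.1 - c.transport j y.2)) 2 γ :=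
  (c.B j).comp_memLp' ((memLp_fst_of_mem_couplings hγ (c.mem_P2 hν j)).sub
    ((c.memLp_transport hρ j).comp_measurePreserving ⟨measurable_snd, hγ.2.2⟩))

lemma integral_sq_norm_sub_eq (hν : ν ∈ P2 d) (hρ : ρ ∈ P2 d) {j : Fin J} (hj : 0 < lam j)
    (hγ : γ ∈ couplings (g j) ρ) :
    ∫ y, ‖y.1 - y.2‖ ^ 2 ∂γ = ∫ x, c.fstPotential j x ∂g j + ∫ y, c.sndPotential j y ∂ρ +
      ∫ y, ‖c.B j (y.1 - c.transport j y.2)‖ ^ 2 ∂γ := by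
  obtain ⟨hint, hsum⟩ := integral_fst_add_snd_of_mem_couplings hγ
    (c.integrable_fstPotential (c.mem_P2 hν j) j) (c.integrable_sndPotential hρ j)
  simp_rw [c.sq_norm_sub_eq_potentials hj]
  rw [integral_add hint ((c.memLp_gap hν hρ hγ).integrable_norm_pow two_ne_zero), hsum]

lemma sum_integral_sq_norm_sub_eq (hlam : ∑ j, lam j = 1) (hν : ν ∈ P2 d) (hρ : ρ ∈ P2 d)
    {γ : Fin J → Measure (Rd d × Rd d)} (hγ : ∀ j, γ j ∈ couplings (g j) ρ) :
    ∑ j, (lam j : ℝ) * ∫ y, ‖y.1 - y.2‖ ^ 2 ∂γ j =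
      ∑ j, (lam j : ℝ) * ∫ x, c.fstPotential j x ∂g j +
        ∑ j, (lam j : ℝ) * ∫ y, ‖c.B j (y.1 - c.transport j y.2)‖ ^ 2 ∂γ j := by
  have hsnd : ∑ j, (lam j : ℝ) * ∫ y, c.sndPotential j y ∂ρ = 0 := by
    simp_rw [← integral_const_mul]
    rw [← integral_finsetSum _ fun j _ => (c.integrable_sndPotential hρ j).const_mul _]
    simp_rw [c.sum_mul_sndPotential hlam, integral_zero]
  rw [← add_zero (∑ j, (lam j : ℝ) * ∫ x, c.fstPotential j x ∂g j), ← hsnd,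
    ← Finset.sum_add_distrib, ← Finset.sum_add_distrib]
  refine Finset.sum_congr rfl fun j _ => ?_
  rcases eq_zero_or_pos (lam j) with hj | hj
  · simp [hj]
  · rw [c.integral_sq_norm_sub_eq hν hρ hj (hγ j)]
    ring

lemma sum_lintegral_enorm_sq_sub_eq (hlam : ∑ j, lam j = 1) (hν : ν ∈ P2 d) (hρ : ρ ∈ P2 d)
    {γ : Fin J → Measure (Rd d × Rd d)} (hγ : ∀ j, γ j ∈ couplings (g j) ρ) :
    ∑ j, (lam j : ℝ≥0∞) * ∫⁻ y, ‖y.1 - y.2‖ₑ ^ 2 ∂γ j =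
      c.cost + ∑ j, (lam j : ℝ≥0∞) * ∫⁻ y, ‖c.B j (y.1 - c.transport j y.2)‖ₑ ^ 2 ∂γ j := by
  have hofReal : ∀ {f : Rd d × Rd d → Fin J → Rd d} {η : Fin J → Measure (Rd d × Rd d)},
      (∀ j, MemLp (f · j) 2 (η j)) → ∑ j, (lam j : ℝ≥0∞) * ∫⁻ y, ‖f y j‖ₑ ^ 2 ∂η j =
        ENNReal.ofReal (∑ j, (lam j : ℝ) * ∫ y, ‖f y j‖ ^ 2 ∂η j) := by
    intro f η hf
    rw [ENNReal.ofReal_sum_of_nonneg fun j _ => by positivity]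
    simp only [ENNReal.ofReal_mul (NNReal.coe_nonneg _), ENNReal.ofReal_coe_nnreal,
      lintegral_enorm_sq_eq_ofReal (hf _)]
  have := hν.1
  have hgap : ∑ j, (lam j : ℝ) * ∫ y, ‖c.B j (y.1 - c.transport j y.2)‖ ^ 2 ∂c.plan j = 0 := by
    refine Finset.sum_eq_zero fun j _ => ?_
    rw [plan, integral_map (by fun_prop) (by fun_prop)]
    simp
  have hdiff : ∀ {τ} (_ : τ ∈ P2 d) {η : Fin J → Measure (Rd d × Rd d)},
      (∀ j, η j ∈ couplings (g j) τ) → ∀ j, MemLp (fun y : Rd d × Rd d => y.1 - y.2) 2 (η j) :=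
    fun hτ _ hη j => (memLp_fst_of_mem_couplings (hη j) (c.mem_P2 hν j)).sub
      (memLp_snd_of_mem_couplings (hη j) hτ)
  rw [cost, hofReal (hdiff hρ hγ), hofReal (hdiff hν c.plan_mem_couplings),
    hofReal fun j => c.memLp_gap hν hρ (hγ j), ← ENNReal.ofReal_add (by positivity) (by positivity),
    c.sum_integral_sq_norm_sub_eq hlam hν hρ hγ,
    c.sum_integral_sq_norm_sub_eq hlam hν hν c.plan_mem_couplings, hgap, add_zero]

lemma cost_ne_top (hν : ν ∈ P2 d) : c.cost ≠ ∞ := by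
  have := hν.1
  refine ENNReal.sum_ne_top.mpr fun j _ => ENNReal.mul_ne_top ENNReal.coe_ne_top
    (lintegral_enorm_sq_ne_top ?_)
  exact (memLp_fst_of_mem_couplings (c.plan_mem_couplings j) (c.mem_P2 hν j)).sub
    (memLp_snd_of_mem_couplings (c.plan_mem_couplings j) hν)

theorem cost_add_sum_W2sq_map_le (hlam : ∑ j, lam j = 1) (hν : ν ∈ P2 d) (hρ : ρ ∈ P2 d) :
    c.cost + ∑ j, (lam j : ℝ≥0∞) *
        W2sq ((g j).map (c.B j)) (ρ.map fun y => c.B j (c.transport j y)) ≤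
      ∑ j, (lam j : ℝ≥0∞) * W2sq (g j) ρ := by
  refine ENNReal.le_of_forall_pos_le_add fun ε hε _ => ?_
  choose γ hγ hle using fun j => exists_mem_couplings_lintegral_lt
    (ENNReal.lt_add_right (W2sq_ne_top (c.mem_P2 hν j) hρ) (ENNReal.coe_pos.mpr hε).ne')
  calc _ ≤ c.cost + ∑ j, (lam j : ℝ≥0∞) *
          ∫⁻ y, ‖c.B j (y.1 - c.transport j y.2)‖ₑ ^ 2 ∂γ j := by
        gcongr with j
        refine (iInf₂_le _ (map_prodMap_mem_couplings (hγ j) (c.B j).measurable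
          (by fun_prop))).trans_eq ?_
        rw [lintegral_map (by fun_prop) (by fun_prop)]
        simp only [Prod.map_fst, Prod.map_snd, map_sub]
    _ = ∑ j, (lam j : ℝ≥0∞) * ∫⁻ y, ‖y.1 - y.2‖ₑ ^ 2 ∂γ j :=
        (c.sum_lintegral_enorm_sq_sub_eq hlam hν hρ hγ).symm
    _ ≤ ∑ j, (lam j : ℝ≥0∞) * (W2sq (g j) ρ + ε) := by
        gcongr with j
        exact (hle j).le
    _ = ∑ j, (lam j : ℝ≥0∞) * W2sq (g j) ρ + ε := by
        simp only [mul_add, Finset.sum_add_distrib, ← Finset.sum_mul]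
        rw [← ENNReal.ofNNReal_finsetSum, hlam, ENNReal.coe_one, one_mul]

lemma cost_le_sum_W2sq (hlam : ∑ j, lam j = 1) (hν : ν ∈ P2 d) (hρ : ρ ∈ P2 d) :
    c.cost ≤ ∑ j, (lam j : ℝ≥0∞) * W2sq (g j) ρ :=
  le_self_add.trans (c.cost_add_sum_W2sq_map_le hlam hν hρ)

lemma sum_W2sq_le_cost [IsProbabilityMeasure ν] :
    ∑ j, (lam j : ℝ≥0∞) * W2sq (g j) ν ≤ c.cost := by
  unfold cost
  gcongr with j
  exact iInf₂_le _ (c.plan_mem_couplings j)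

theorem mmW2sq_eq_cost (hlam : ∑ j, lam j = 1) (hν : ν ∈ P2 d) : mmW2sq lam g = c.cost := by
  have := hν.1
  apply le_antisymm
  · have hη : ν.map (fun z j => c.transport j z) ∈ multiCouplings g := by
      refine ⟨Measure.isProbabilityMeasure_map (by fun_prop), fun j => ?_⟩
      rw [Measure.map_map (by fun_prop) (by fun_prop), ← c.map_transport j]
      rfl
    refine (iInf₂_le _ hη).trans_eq ?_
    simp_rw [half_sum_sum_enorm_sq_sub hlam]
    rw [lintegral_map (by fun_prop) (by fun_prop), cost,
      lintegral_finsetSum _ fun j _ => by fun_prop]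
    refine Finset.sum_congr rfl fun j _ => ?_
    rw [plan, lintegral_map (by fun_prop) (by fun_prop), lintegral_const_mul _ (by fun_prop)]
    simp only [c.sum_smul_transport]
  · refine le_iInf₂ fun η hη => ?_
    obtain ⟨ρ, hρ, hle⟩ := exists_sum_W2sq_le_multiCost hlam (c.mem_P2 hν) hη
    exact (c.cost_le_sum_W2sq hlam hν hρ).trans hle

include c in
lemma mmW2sq_ne_top (hlam : ∑ j, lam j = 1) (hν : ν ∈ P2 d) : mmW2sq lam g ≠ ∞ :=
  (c.mmW2sq_eq_cost hlam hν).trans_ne (c.cost_ne_top hν)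

lemma measurableEmbedding_comp_transport {j : Fin J} (hj : 0 < lam j) :
    MeasurableEmbedding fun y => c.B j (c.transport j y) := by
  refine Measurable.measurableEmbedding (by fun_prop) fun y y' h => ?_
  have hBT : c.B j (c.T j (y - y')) = 0 := by
    rw [map_sub, ← add_sub_add_right_eq_sub _ _ (c.b j), map_sub]
    exact sub_eq_zero.mpr h
  have hinner := c.inner_eq j hj (y - y') (y - y')
  rw [hBT, inner_zero_right] at hinner
  exact sub_eq_zero.mp (inner_self_eq_zero.mp hinner.symm)

theorem eq_of_sum_W2sq_le_cost (hlam : ∑ j, lam j = 1) (hν : ν ∈ P2 d) (hρ : ρ ∈ P2 d)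
    (h : ∑ j, (lam j : ℝ≥0∞) * W2sq (g j) ρ ≤ c.cost) : ρ = ν := by
  have := hρ.1
  have := (c.mem_P2 hν · |>.1)
  obtain ⟨j, -, hj⟩ := Finset.exists_ne_zero_of_sum_ne_zero (hlam.trans_ne one_ne_zero)
  have hemb := c.measurableEmbedding_comp_transport hj.bot_lt
  have hgap : ∑ j, (lam j : ℝ≥0∞) *
      W2sq ((g j).map (c.B j)) (ρ.map fun y => c.B j (c.transport j y)) = 0 :=
    nonpos_iff_eq_zero.mp <| (ENNReal.add_le_add_iff_left (c.cost_ne_top hν)).mp <|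
      ((c.cost_add_sum_W2sq_map_le hlam hν hρ).trans h).trans_eq (add_zero _).symm
  have hW : W2sq ((g j).map (c.B j)) (ρ.map fun y => c.B j (c.transport j y)) = 0 :=
    (mul_eq_zero.mp (Finset.sum_eq_zero_iff.mp hgap j (Finset.mem_univ j))).resolve_left
      (ENNReal.coe_ne_zero.mpr hj)
  have : IsProbabilityMeasure ((g j).map (c.B j)) :=
    Measure.isProbabilityMeasure_map (by fun_prop)
  have : IsProbabilityMeasure (ρ.map fun y => c.B j (c.transport j y)) :=
    Measure.isProbabilityMeasure_map (by fun_prop)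
  have hmap := eq_of_W2sq_eq_zero hW
  rw [← c.map_transport j, Measure.map_map (by fun_prop) (by fun_prop)] at hmap
  have hcomap := congrArg (Measure.comap fun y => c.B j (c.transport j y)) hmap
  rw [hemb.comap_map] at hcomap
  exact hcomap.symm.trans (hemb.comap_map ν)

include c in
theorem isW2Barycenter_iff (hlam : ∑ j, lam j = 1) (hν : ν ∈ P2 d) :
    IsW2Barycenter lam g ρ ↔ ρ = ν := by
  have := hν.1
  constructor
  · intro h
    exact c.eq_of_sum_W2sq_le_cost hlam hν h.1 ((h.2 ν hν).trans c.sum_W2sq_le_cost)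
  · rintro rfl
    exact ⟨hν, fun ρ hρ => c.sum_W2sq_le_cost.trans (c.cost_le_sum_W2sq hlam hν hρ)⟩

end BarycentricMaps

section FiniteTransport

variable {ι κ η X Y : Type*} [Fintype ι] [Fintype κ] [Fintype η]

/-- Nonnegative matrices with row sums `p` and column sums `q`. -/
def pairCouplings (p : κ → ℝ≥0) (q : η → ℝ≥0) : Set (κ × η → ℝ≥0) :=
  {w | (∀ a, ∑ l, w (a, l) = p a) ∧ ∀ l, ∑ a, w (a, l) = q l}

lemma pairCouplings_nonempty {p : κ → ℝ≥0} {q : η → ℝ≥0} (hp : ∑ a, p a = 1)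
    (hq : ∑ l, q l = 1) : (pairCouplings p q).Nonempty :=
  ⟨fun k => p k.1 * q k.2, fun a => by simp [← Finset.mul_sum, hq],
    fun l => by simp [← Finset.sum_mul, hp]⟩

lemma isCompact_pairCouplings (p : κ → ℝ≥0) (q : η → ℝ≥0) : IsCompact (pairCouplings p q) := by
  have hclosed : IsClosed (pairCouplings p q) := by
    simp only [pairCouplings, Set.ofPred_and, Set.ofPred_forall]
    exact (isClosed_iInter fun a => isClosed_eq (by fun_prop) continuous_const).inter
      (isClosed_iInter fun l => isClosed_eq (by fun_prop) continuous_const)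
  refine (isCompact_Icc (a := 0) (b := fun k => p k.1)).of_isClosed_subset hclosed
    fun w hw => ⟨zero_le, fun k => ?_⟩
  change w k ≤ p k.1
  rw [← hw.1]
  exact Finset.single_le_sum (f := fun l => w (k.1, l)) (fun _ _ => zero_le) (Finset.mem_univ k.2)

lemma exists_forall_sum_mul_le_of_isCompact {C : Set (κ → ℝ≥0)} (hC : IsCompact C)
    (hne : C.Nonempty) {c : κ → ℝ≥0∞} (hc : ∀ x, c x ≠ ∞) :
    ∃ w ∈ C, ∀ w' ∈ C, ∑ x, (w x : ℝ≥0∞) * c x ≤ ∑ x, (w' x : ℝ≥0∞) * c x :=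
  hC.exists_isMinOn hne <| Continuous.continuousOn <| continuous_finsetSum _ fun x _ =>
    (ENNReal.continuous_mul_const (hc x)).comp
      (ENNReal.continuous_coe.comp (continuous_apply x))

/-- Independent gluing of weights `u j` with common total mass `q`: the product of the normalized
weights, rescaled to total mass `q`. For `q = 0` all factors vanish, and so does the result. -/
noncomputable def glueWeights {κ : ι → Type*} (q : ℝ≥0) (u : (j : ι) → κ j → ℝ≥0)
    (k : (j : ι) → κ j) : ℝ≥0 :=
  q * ∏ j, (u j (k j) / q)

lemma sum_glueWeights [DecidableEq ι] {κ : ι → Type*} [∀ j, Fintype (κ j)]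
    [∀ j, DecidableEq (κ j)] {q : ℝ≥0} {u : (j : ι) → κ j → ℝ≥0} (hu : ∀ j, ∑ a, u j a = q)
    (j : ι) (a : κ j) : ∑ k with k j = a, glueWeights q u k = u j a := by
  rcases eq_or_ne q 0 with rfl | hq
  · have huj : u j a = 0 := Finset.sum_eq_zero_iff.mp (hu j) a (Finset.mem_univ a)
    simp [glueWeights, huj]
  have hfiber : (Finset.univ.filter fun k : (j : ι) → κ j => k j = a) =
      Fintype.piFinset (Function.update (fun _ => Finset.univ) j {a}) := by
    ext k
    simp [Fintype.mem_piFinset, Function.forall_update_iff _ (fun i s => k i ∈ s)]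
  simp only [glueWeights]
  rw [← Finset.mul_sum, hfiber, ← Finset.prod_univ_sum _ (fun i b => u i b / q),
    ← Finset.mul_prod_erase _ _ (Finset.mem_univ j), Function.update_self, Finset.sum_singleton,
    Finset.prod_eq_one, mul_one, mul_div_cancel₀ _ hq]
  intro i hi
  rw [Function.update_of_ne (Finset.ne_of_mem_erase hi), ← Finset.sum_div, hu i, div_self hq]

lemma exists_coupling_of_fiber_sums_eq [DecidableEq X] {f : ι → X} {g : κ → X} {r : ι → ℝ≥0}
    {p : κ → ℝ≥0} (h : ∀ x, ∑ i with f i = x, r i = ∑ a with g a = x, p a) :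
    ∃ u : ι → κ → ℝ≥0, (∀ i, ∑ a, u i a = r i) ∧ (∀ a, ∑ i, u i a = p a) ∧
      ∀ i a, u i a ≠ 0 → f i = g a := by
  refine ⟨fun i a => if f i = g a then r i * p a / ∑ b with g b = g a, p b else 0,
    fun i => ?_, fun a => ?_, fun i a => not_imp_comm.mp fun hne => if_neg hne⟩
  · have hcongr : ∀ a ∈ Finset.univ.filter (fun a => f i = g a),
        r i * p a / ∑ b with g b = g a, p b = r i / (∑ b with g b = f i, p b) * p a := by
      intro a ha
      rw [(Finset.mem_filter.mp ha).2, mul_div_right_comm]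
    rw [← Finset.sum_filter, Finset.sum_congr rfl hcongr, ← Finset.mul_sum]
    simp_rw [eq_comm (a := f i)]
    refine div_mul_cancel_of_imp fun h0 => ?_
    rw [← h] at h0
    exact Finset.sum_eq_zero_iff.mp h0 i (by simp)
  · rw [← Finset.sum_filter]
    simp_rw [mul_div_assoc]
    rw [← Finset.sum_mul, h]
    refine mul_div_cancel_of_imp' fun h0 => ?_
    exact Finset.sum_eq_zero_iff.mp h0 a (by simp)

lemma sum_mul_div_of_sum_eq {u : κ → ℝ≥0} {v : η → ℝ≥0} {r : ℝ≥0} (hu : ∑ a, u a = r)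
    (hv : ∑ l, v l = r) (a : κ) : ∑ l, u a * v l / r = u a := by
  rw [← Finset.sum_div, ← Finset.mul_sum, hv]
  refine mul_div_cancel_of_imp fun h0 => ?_
  rw [h0] at hu
  exact Finset.sum_eq_zero_iff.mp hu a (Finset.mem_univ a)

lemma exists_sum_mem_pairCouplings_of_fiber_sums_eq [DecidableEq X] [DecidableEq Y]
    {f : ι → X} {f' : ι → Y} {g : κ → X} {g' : η → Y} {r : ι → ℝ≥0} {p : κ → ℝ≥0} {q : η → ℝ≥0}
    (hp : ∀ x, ∑ i with f i = x, r i = ∑ a with g a = x, p a)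
    (hq : ∀ y, ∑ i with f' i = y, r i = ∑ l with g' l = y, q l) :
    ∃ W : ι → κ × η → ℝ≥0, ∑ i, W i ∈ pairCouplings p q ∧ (∀ i, ∑ k, W i k = r i) ∧
      ∀ i k, W i k ≠ 0 → f i = g k.1 ∧ f' i = g' k.2 := by
  obtain ⟨u, hur, hup, hu⟩ := exists_coupling_of_fiber_sums_eq hp
  obtain ⟨v, hvr, hvq, hv⟩ := exists_coupling_of_fiber_sums_eq hq
  have hrow : ∀ i a, ∑ l, u i a * v i l / r i = u i a := fun i =>
    sum_mul_div_of_sum_eq (hur i) (hvr i)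
  have hcol : ∀ i l, ∑ a, u i a * v i l / r i = v i l := fun i l => by
    simp_rw [mul_comm (u i _)]
    exact sum_mul_div_of_sum_eq (hvr i) (hur i) l
  refine ⟨fun i k => u i k.1 * v i k.2 / r i, ⟨fun a => ?_, fun l => ?_⟩, fun i => ?_,
    fun i k hne => ⟨hu i k.1 ?_, hv i k.2 ?_⟩⟩
  · simp_rw [Finset.sum_apply]
    rw [Finset.sum_comm]
    simp_rw [hrow, hup]
  · simp_rw [Finset.sum_apply]
    rw [Finset.sum_comm]
    simp_rw [hcol, hvq]
  · rw [Fintype.sum_prod_type]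
    simp_rw [hrow, hur]
  · exact fun h0 => hne (by simp [h0])
  · exact fun h0 => hne (by simp [h0])

end FiniteTransport

section DiscreteProgram

variable {d J : ℕ} {K : Fin J → ℕ} {p : (j : Fin J) → Fin (K j) → ℝ≥0}
  {w w' : ((j : Fin J) → Fin (K j)) → ℝ≥0} {lam : Fin J → ℝ≥0}
  {g : (j : Fin J) → Fin (K j) → Measure (Rd d)}

lemma sum_smul_comp_eval {M : Type*} [AddCommMonoid M] [Module ℝ≥0 M]
    (hw : w ∈ discreteCouplings p) (j : Fin J) (f : Fin (K j) → M) :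
    ∑ k, w k • f (k j) = ∑ a, p j a • f a := by
  rw [← Finset.sum_fiberwise (g := fun k => k j)]
  refine Finset.sum_congr rfl fun a _ => ?_
  rw [← hw j a, Finset.sum_smul]
  refine Finset.sum_congr rfl fun k hk => ?_
  rw [(Finset.mem_filter.mp hk).2]

lemma sum_eq_of_mem_discreteCouplings (hw : w ∈ discreteCouplings p) (j : Fin J) :
    ∑ k, w k = ∑ a, p j a := by
  simpa using sum_smul_comp_eval hw j fun _ => (1 : ℝ≥0)

lemma isCompact_discreteCouplings [Nonempty (Fin J)] (p : (j : Fin J) → Fin (K j) → ℝ≥0) :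
    IsCompact (discreteCouplings p) := by
  have hclosed : IsClosed (discreteCouplings p) := by
    simp only [discreteCouplings, Set.ofPred_forall]
    exact isClosed_iInter fun j => isClosed_iInter fun a =>
      isClosed_eq (by fun_prop) continuous_const
  obtain ⟨j⟩ := ‹Nonempty (Fin J)›
  refine (isCompact_Icc (a := 0) (b := fun k => p j (k j))).of_isClosed_subset hclosed
    fun w hw => ⟨zero_le, fun k => ?_⟩
  change w k ≤ p j (k j)
  rw [← hw]
  exact Finset.single_le_sum (fun _ _ => zero_le) (by simp)

lemma exists_isOptimalDiscrete [Nonempty (Fin J)] (hp : ∀ j, ∑ a, p j a = 1)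
    (hfin : ∀ k : (j : Fin J) → Fin (K j), mmW2sq lam (fun j => g j (k j)) ≠ ∞) :
    ∃ w, IsOptimalDiscrete lam p g w :=
  exists_forall_sum_mul_le_of_isCompact (isCompact_discreteCouplings p)
    ⟨glueWeights 1 p, sum_glueWeights hp⟩ hfin

lemma exists_pos_mul_le_of_support_subset {X : Type*} [Finite X] {v v' : X → ℝ≥0}
    (h : Function.support v' ⊆ Function.support v) : ∃ t : ℝ≥0, 0 < t ∧ ∀ x, t * v' x ≤ v x := by
  have := Fintype.ofFinite X
  refine ⟨(∑ x, v' x / v x + 1)⁻¹, by positivity, fun x => ?_⟩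
  rw [inv_mul_le_iff₀ (by positivity)]
  calc v' x = v' x / v x * v x :=
        (div_mul_cancel_of_imp fun h0 => by_contra fun h0' => h h0' h0).symm
    _ ≤ (∑ x, v' x / v x + 1) * v x := by
      gcongr
      exact le_add_right (Finset.single_le_sum (f := fun x => v' x / v x) (fun _ _ => zero_le)
        (Finset.mem_univ x))

-- Complementary slackness: if `t * w' ≤ w`, exchanging `t * w'` for `t * w` in `w` keeps it
-- admissible, so optimality of `w` forces `w'` to cost at most as much as `w`.
lemma IsOptimalDiscrete.of_support_subset (hopt : IsOptimalDiscrete lam p g w)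
    (hfin : ∀ k : (j : Fin J) → Fin (K j), mmW2sq lam (fun j => g j (k j)) ≠ ∞)
    (hw' : w' ∈ discreteCouplings p) (hsub : Function.support w' ⊆ Function.support w) :
    IsOptimalDiscrete lam p g w' := by
  obtain ⟨t, ht, hle⟩ := exists_pos_mul_le_of_support_subset hsub
  obtain ⟨v, rfl⟩ : ∃ v, w = v + t • w' :=
    ⟨fun k => w k - t * w' k, funext fun k => (tsub_add_cancel_of_le (hle k)).symm⟩
  set w := v + t • w'
  have hadm : v + t • w ∈ discreteCouplings p := fun j a => by
    have hv := hopt.1 j a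
    simp only [w, Pi.add_apply, Pi.smul_apply, smul_eq_mul, Finset.sum_add_distrib,
      ← Finset.mul_sum, hw' j a] at hv
    simp only [Pi.add_apply, Pi.smul_apply, smul_eq_mul, Finset.sum_add_distrib, ← Finset.mul_sum,
      hopt.1 j a, hv]
  have hcost : ∀ u,
      discreteCost lam g (v + t • u) = discreteCost lam g v + t * discreteCost lam g u :=
    fun u => by
      simp [discreteCost, add_mul, Finset.sum_add_distrib, Finset.mul_sum, mul_assoc]
  have hv_fin : discreteCost lam g v ≠ ∞ :=
    ENNReal.sum_ne_top.mpr fun k _ => ENNReal.mul_ne_top ENNReal.coe_ne_top (hfin k)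
  have hswap : discreteCost lam g w' ≤ discreteCost lam g w := by
    have := hopt.2 _ hadm
    rw [hcost, hcost, ENNReal.add_le_add_iff_left hv_fin] at this
    exact (ENNReal.mul_le_mul_iff_right (by exact_mod_cast ht.ne') ENNReal.coe_ne_top).mp this
  exact ⟨hw', fun u hu => hswap.trans (hopt.2 u hu)⟩

end DiscreteProgram

section MarginalIndicator

variable {ι : Type*} {κ : ι → Type*} [∀ j, DecidableEq (κ j)]

/-- The `0`-`1` vector indexed by the pairs `(j, a)` that marks the entries `(j, k j)`, that is, the
family of marginals of the unit mass at the multi-index `k`. -/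
def marginalIndicator (k : (j : ι) → κ j) (j : ι) : κ j → ℝ :=
  Pi.single (k j) 1

-- The coordinates of `marginalIndicator k` sum to one in each block `j`, so these vectors lie in an
-- affine subspace of codimension `card ι`.
lemma card_add_card_le_of_affineIndependent_marginalIndicator [Fintype ι] [∀ j, Fintype (κ j)]
    [∀ j, Nonempty (κ j)] {I : Type*} [Fintype I] {z : I → (j : ι) → κ j}
    (hz : AffineIndependent ℝ fun i => marginalIndicator (z i)) :
    Fintype.card I + Fintype.card ι ≤ ∑ j, Fintype.card (κ j) + 1 := by
  classical
  let blockSum : ((j : ι) → κ j → ℝ) →ₗ[ℝ] ι → ℝ :=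
    LinearMap.pi fun j => (∑ a, LinearMap.proj a) ∘ₗ LinearMap.proj j
  have hblock : ∀ x j, blockSum x j = ∑ a, x j a := fun x j => by simp [blockSum]
  have hsurj : LinearMap.range blockSum = ⊤ := by
    refine LinearMap.range_eq_top.mpr fun y =>
      ⟨fun j => Pi.single (Classical.arbitrary (κ j)) (y j), funext fun j => ?_⟩
    rw [hblock, Finset.sum_pi_single']
    simp
  have hker : vectorSpan ℝ (Set.range fun i => marginalIndicator (z i)) ≤ blockSum.ker := by
    rw [vectorSpan_def, Submodule.span_le]
    rintro _ ⟨_, ⟨i, rfl⟩, _, ⟨i', rfl⟩, rfl⟩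
    ext j
    simp [hblock, marginalIndicator]
  have hrank := blockSum.finrank_range_add_finrank_ker
  rw [hsurj, finrank_top, Module.finrank_fintype_fun_eq_card, Module.finrank_pi_fintype] at hrank
  simp only [Module.finrank_fintype_fun_eq_card] at hrank
  have := hz.card_le_finrank_succ
  have := Submodule.finrank_mono hker
  omega

end MarginalIndicator

section Sparsity

variable {d J : ℕ} {K : Fin J → ℕ} {p : (j : Fin J) → Fin (K j) → ℝ≥0}
  {w : ((j : Fin J) → Fin (K j)) → ℝ≥0} {lam : Fin J → ℝ≥0}
  {g : (j : Fin J) → Fin (K j) → Measure (Rd d)}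

lemma sum_smul_marginalIndicator_eq_iff :
    ∑ k, (w k : ℝ) • marginalIndicator k = (fun j a => (p j a : ℝ)) ↔ w ∈ discreteCouplings p := by
  simp only [funext_iff, Finset.sum_apply, Pi.smul_apply, marginalIndicator, Pi.single_apply,
    smul_eq_mul, mul_ite, mul_one, mul_zero, ← Finset.sum_filter, discreteCouplings]
  simp only [Set.mem_ofPred_eq, eq_comm, ← NNReal.coe_inj, NNReal.coe_sum]

lemma mem_convexHull_marginalIndicator (hw : w ∈ discreteCouplings p) (hsum : ∑ k, w k = 1) :
    (fun j a => (p j a : ℝ)) ∈ convexHull ℝ (marginalIndicator '' Function.support w) := by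
  have hsum' : ∑ k with w k ≠ 0, (w k : ℝ) = 1 := by
    rw [← NNReal.coe_sum, Finset.sum_filter_ne_zero, hsum, NNReal.coe_one]
  rw [← sum_smul_marginalIndicator_eq_iff.mpr hw,
    ← Finset.sum_filter_of_ne (p := (w · ≠ 0)) fun k _ h h0 => h (by simp [h0])]
  exact (convex_convexHull ℝ _).sum_mem (fun k _ => (w k).coe_nonneg) hsum' fun k hk =>
    subset_convexHull ℝ _ ⟨k, (Finset.mem_filter.mp hk).2, rfl⟩

lemma exists_mem_discreteCouplings_support_subset [Nonempty (Fin J)] (hp : ∀ j, ∑ a, p j a = 1)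
    (hw : w ∈ discreteCouplings p) :
    ∃ w' ∈ discreteCouplings p, Function.support w' ⊆ Function.support w ∧
      (Finset.univ.filter (w' · ≠ 0)).card + J ≤ ∑ j, K j + 1 := by
  classical
  obtain ⟨j₀⟩ := ‹Nonempty (Fin J)›
  have : ∀ j, Nonempty (Fin (K j)) := fun j => by
    by_contra! h
    simpa using hp j
  obtain ⟨I, _, v, t, hv, hind, htpos, -, hteq⟩ :=
    eq_pos_convex_span_of_mem_convexHull (mem_convexHull_marginalIndicator hw
      ((sum_eq_of_mem_discreteCouplings hw j₀).trans (hp j₀)))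
  choose z hzw hzv using fun i => hv ⟨i, rfl⟩
  obtain rfl : (fun i => marginalIndicator (z i)) = v := funext hzv
  lift t to I → ℝ≥0 using fun i => (htpos i).le
  have hsupp : ∀ k, ∑ i with z i = k, t i ≠ 0 → ∃ i, z i = k := fun k hk => by
    obtain ⟨i, hi, -⟩ := Finset.exists_ne_zero_of_sum_ne_zero hk
    exact ⟨i, (Finset.mem_filter.mp hi).2⟩
  refine ⟨fun k => ∑ i with z i = k, t i, ?_, fun k hk => ?_, ?_⟩
  · rw [← sum_smul_marginalIndicator_eq_iff, ← hteq, ← Finset.sum_fiberwise (g := z)]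
    refine Finset.sum_congr rfl fun k _ => ?_
    rw [NNReal.coe_sum, Finset.sum_smul]
    exact Finset.sum_congr rfl fun i hi => by rw [← (Finset.mem_filter.mp hi).2]
  · obtain ⟨i, rfl⟩ := hsupp k hk
    exact hzw i
  · have hcard : (Finset.univ.filter fun k => ∑ i with z i = k, t i ≠ 0).card ≤ Fintype.card I :=
      Finset.card_le_card_of_surjOn z fun k hk =>
        (hsupp k (Finset.mem_filter.mp hk).2).imp fun i hi => ⟨by simp, hi⟩
    have := card_add_card_le_of_affineIndependent_marginalIndicator hind
    simp only [Fintype.card_fin] at this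
    exact (Nat.add_le_add_right hcard J).trans this

theorem exists_sparse_isOptimalDiscrete [Nonempty (Fin J)] (hp : ∀ j, ∑ a, p j a = 1)
    (hfin : ∀ k : (j : Fin J) → Fin (K j), mmW2sq lam (fun j => g j (k j)) ≠ ∞) :
    ∃ w, IsOptimalDiscrete lam p g w ∧
      (Finset.univ.filter (fun k => w k ≠ 0)).card + J ≤ (∑ j, K j) + 1 := by
  obtain ⟨w, hw⟩ := exists_isOptimalDiscrete hp hfin
  obtain ⟨w', hw', hsub, hcard⟩ := exists_mem_discreteCouplings_support_subset hp hw.1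
  exact ⟨w', hw.of_support_subset hfin hw' hsub, hcard⟩

end Sparsity

section GaussianMixtures

variable {d : ℕ} {κ η : Type*} [Fintype κ] [Fintype η]

lemma map_sum_smul {Ω Ω' : Type*} [MeasurableSpace Ω] [MeasurableSpace Ω'] (r : κ → ℝ≥0)
    (G : κ → Measure Ω) {f : Ω → Ω'} (hf : Measurable f) :
    (∑ i, r i • G i).map f = ∑ i, r i • (G i).map f := by
  rw [← Measure.mapₗ_apply_of_measurable hf, map_sum]
  refine Finset.sum_congr rfl fun i _ => ?_
  rw [Measure.mapₗ_apply_of_measurable hf, Measure.map_smul]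

lemma lintegral_sum_smul {Ω : Type*} [MeasurableSpace Ω] (r : κ → ℝ≥0) (G : κ → Measure Ω)
    (f : Ω → ℝ≥0∞) : ∫⁻ x, f x ∂(∑ i, r i • G i) = ∑ i, (r i : ℝ≥0∞) * ∫⁻ x, f x ∂G i := by
  rw [lintegral_finsetSum_measure]
  exact Finset.sum_congr rfl fun i _ => lintegral_smul_measure ..

lemma sum_smul_mem_GMMInf {E : Type*} [TopologicalSpace E] [AddCommMonoid E] [Module ℝ E]
    [MeasurableSpace E] {w : κ → ℝ≥0} (hw : ∑ x, w x = 1) {α : κ → Measure E}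
    (hα : ∀ x, IsGaussian (α x)) : ∑ x, w x • α x ∈ GMMInf E := by
  let e := Fintype.equivFin κ
  refine Set.mem_iUnion.mpr ⟨Fintype.card κ, w ∘ e.symm, α ∘ e.symm, ?_, fun k => hα _, ?_⟩
  · rw [← hw]
    exact Equiv.sum_comp e.symm w
  · exact (Equiv.sum_comp e.symm fun x => w x • α x).symm

lemma sum_smul_mem_couplings {w : κ → ℝ≥0} (hw : ∑ k, w k = 1) {α β : κ → Measure (Rd d)}
    {γ : κ → Measure (Rd d × Rd d)} (hγ : ∀ k, γ k ∈ couplings (α k) (β k)) :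
    ∑ k, w k • γ k ∈ couplings (∑ k, w k • α k) (∑ k, w k • β k) := by
  refine ⟨⟨?_⟩, ?_, ?_⟩
  · have huniv : ∀ k, γ k Set.univ = 1 := fun k => (hγ k).1.measure_univ
    simp only [Measure.finsetSum_apply, Measure.smul_apply, huniv, ENNReal.smul_def, smul_eq_mul,
      mul_one]
    exact_mod_cast hw
  · simp_rw [map_sum_smul _ _ measurable_fst, (hγ _).2.1]
  · simp_rw [map_sum_smul _ _ measurable_snd, (hγ _).2.2]

lemma MW2sq_sum_smul_le {w : κ → ℝ≥0} (hw : ∑ k, w k = 1) {α β : κ → Measure (Rd d)}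
    {γ : κ → Measure (Rd d × Rd d)} (hγ : ∀ k, γ k ∈ couplings (α k) (β k))
    (hG : ∀ k, IsGaussian (γ k)) :
    MW2sq (∑ k, w k • α k) (∑ k, w k • β k) ≤
      ∑ k, (w k : ℝ≥0∞) * ∫⁻ y, ‖y.1 - y.2‖ₑ ^ 2 ∂γ k :=
  (iInf₂_le _ ⟨sum_smul_mem_couplings hw hγ, sum_smul_mem_GMMInf hw hG⟩).trans
    (lintegral_sum_smul w γ _).le

lemma exists_pairCoupling_le_of_mem_GMMInf {p : κ → ℝ≥0} {q : η → ℝ≥0}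
    {α : κ → Measure (Rd d)} {β : η → Measure (Rd d)} (hα : ∀ a, IsGaussian (α a))
    (hβ : ∀ l, IsGaussian (β l)) {γ : Measure (Rd d × Rd d)}
    (hγ : γ ∈ couplings (∑ a, p a • α a) (∑ l, q l • β l)) (hγG : γ ∈ GMMInf (Rd d × Rd d)) :
    ∃ w ∈ pairCouplings p q,
      ∑ k, (w k : ℝ≥0∞) * W2sq (α k.1) (β k.2) ≤ ∫⁻ y, ‖y.1 - y.2‖ₑ ^ 2 ∂γ := by
  classical
  obtain ⟨N, r, G, -, hG, rfl⟩ := Set.mem_iUnion.mp hγG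
  obtain ⟨-, hfst, hsnd⟩ := hγ
  rw [map_sum_smul r G measurable_fst] at hfst
  rw [map_sum_smul r G measurable_snd] at hsnd
  have hGfst : ∀ i, IsGaussian ((G i).map Prod.fst) := fun i =>
    isGaussian_map (ContinuousLinearMap.fst ℝ (Rd d) (Rd d))
  have hGsnd : ∀ i, IsGaussian ((G i).map Prod.snd) := fun i =>
    isGaussian_map (ContinuousLinearMap.snd ℝ (Rd d) (Rd d))
  -- By identifiability, the components of `γ` whose first marginal is a given Gaussian have the
  -- same total weight as the components of the first mixture equal to it; likewise for the second.
  obtain ⟨W, hW, hWr, hWeq⟩ := exists_sum_mem_pairCouplings_of_fiber_sums_eq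
    (gaussianMixture_weights_eq hGfst hα hfst)
    (gaussianMixture_weights_eq hGsnd hβ hsnd)
  refine ⟨∑ i, W i, hW, ?_⟩
  calc ∑ k, ((∑ i, W i) k : ℝ≥0∞) * W2sq (α k.1) (β k.2)
      = ∑ i, ∑ k, (W i k : ℝ≥0∞) * W2sq (α k.1) (β k.2) := by
        simp_rw [Finset.sum_apply, ENNReal.ofNNReal_finsetSum, Finset.sum_mul]
        exact Finset.sum_comm
    _ = ∑ i, ∑ k, (W i k : ℝ≥0∞) * W2sq ((G i).map Prod.fst) ((G i).map Prod.snd) := by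
        refine Finset.sum_congr rfl fun i _ => Finset.sum_congr rfl fun k _ => ?_
        rcases eq_or_ne (W i k) 0 with h0 | h0
        · simp [h0]
        · rw [(hWeq i k h0).1, (hWeq i k h0).2]
    _ = ∑ i, (r i : ℝ≥0∞) * W2sq ((G i).map Prod.fst) ((G i).map Prod.snd) := by
        simp_rw [← Finset.sum_mul, ← ENNReal.ofNNReal_finsetSum, hWr]
    _ ≤ ∑ i, (r i : ℝ≥0∞) * ∫⁻ y, ‖y.1 - y.2‖ₑ ^ 2 ∂G i := by
        gcongr with i
        have := hG i
        exact iInf₂_le _ ⟨inferInstance, rfl, rfl⟩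
    _ = ∫⁻ y, ‖y.1 - y.2‖ₑ ^ 2 ∂∑ i, r i • G i := (lintegral_sum_smul r G _).symm

theorem exists_pairCoupling_le_MW2sq {p : κ → ℝ≥0} {q : η → ℝ≥0} (hp : ∑ a, p a = 1)
    (hq : ∑ l, q l = 1) {α : κ → Measure (Rd d)} {β : η → Measure (Rd d)}
    (hα : ∀ a, IsGaussian (α a)) (hβ : ∀ l, IsGaussian (β l)) :
    ∃ w ∈ pairCouplings p q, ∑ k, (w k : ℝ≥0∞) * W2sq (α k.1) (β k.2) ≤
      MW2sq (∑ a, p a • α a) (∑ l, q l • β l) := by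
  obtain ⟨w, hw, hmin⟩ := exists_forall_sum_mul_le_of_isCompact (isCompact_pairCouplings p q)
    (pairCouplings_nonempty hp hq) (c := fun k => W2sq (α k.1) (β k.2))
    fun k => W2sq_ne_top (mem_P2_of_isGaussian _) (mem_P2_of_isGaussian _)
  refine ⟨w, hw, le_iInf₂ fun γ hγ => ?_⟩
  obtain ⟨w', hw', hle⟩ := exists_pairCoupling_le_of_mem_GMMInf hα hβ hγ.1 hγ.2
  exact (hmin w' hw').trans hle

end GaussianMixtures

section MW2Barycenters

variable {d J : ℕ} {K : Fin J → ℕ} {p : (j : Fin J) → Fin (K j) → ℝ≥0} {lam : Fin J → ℝ≥0}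
  {g : (j : Fin J) → Fin (K j) → Measure (Rd d)} {η : Type*} [Fintype η] {q : η → ℝ≥0}
  {β : η → Measure (Rd d)} {ν : ((j : Fin J) → Fin (K j)) → Measure (Rd d)} {ρ : Measure (Rd d)}

lemma le_of_sum_le_sum_of_forall_le {X : Type*} [Fintype X] {a b : X → ℝ≥0∞}
    (hle : ∀ x, a x ≤ b x) (hsum : ∑ x, b x ≤ ∑ x, a x) (hfin : ∑ x, a x ≠ ∞) (x : X) :
    b x ≤ a x := by
  classical
  rw [← Finset.add_sum_erase _ a (Finset.mem_univ x)] at hsum hfin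
  rw [← Finset.add_sum_erase _ b (Finset.mem_univ x)] at hsum
  refine (ENNReal.add_le_add_iff_right (ENNReal.add_ne_top.mp hfin).2).mp (le_trans ?_ hsum)
  gcongr with y
  exact hle y

lemma sum_mem_discreteCouplings_of_pairCouplings {u : (j : Fin J) → Fin (K j) × η → ℝ≥0}
    (hu : ∀ j, u j ∈ pairCouplings (p j) q) {W : η → ((j : Fin J) → Fin (K j)) → ℝ≥0}
    (hW : ∀ l, W l ∈ discreteCouplings fun j a => u j (a, l)) :
    ∑ l, W l ∈ discreteCouplings p := fun j a => by
  simp_rw [Finset.sum_apply]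
  rw [Finset.sum_comm, ← (hu j).1 a]
  exact Finset.sum_congr rfl fun l _ => hW l j a

lemma exists_tensors_sum_W2sq_le_sum_MW2sq [Nonempty (Fin J)] (hp : ∀ j, ∑ a, p j a = 1)
    (hg : ∀ j a, IsGaussian (g j a)) (hq : ∑ l, q l = 1) (hβ : ∀ l, IsGaussian (β l)) :
    ∃ W : η → ((j : Fin J) → Fin (K j)) → ℝ≥0,
      ∑ l, W l ∈ discreteCouplings p ∧ (∀ l, ∑ k, W l k = q l) ∧
      ∑ x : η × ((j : Fin J) → Fin (K j)),
          (W x.1 x.2 : ℝ≥0∞) * ∑ j, (lam j : ℝ≥0∞) * W2sq (g j (x.2 j)) (β x.1) ≤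
        ∑ j, (lam j : ℝ≥0∞) * MW2sq (∑ a, p j a • g j a) (∑ l, q l • β l) := by
  choose u hu hle using fun j => exists_pairCoupling_le_MW2sq (hp j) hq (hg j) hβ
  have hW : ∀ l, glueWeights (q l) (fun j a => u j (a, l)) ∈
      discreteCouplings fun j a => u j (a, l) := fun l => sum_glueWeights fun j => (hu j).2 l
  set W : η → ((j : Fin J) → Fin (K j)) → ℝ≥0 := fun l =>
    glueWeights (q l) fun j a => u j (a, l)
  refine ⟨W, sum_mem_discreteCouplings_of_pairCouplings hu hW, fun l => ?_, ?_⟩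
  · obtain ⟨j⟩ := ‹Nonempty (Fin J)›
    exact (sum_eq_of_mem_discreteCouplings (hW l) j).trans ((hu j).2 l)
  calc ∑ x : η × ((j : Fin J) → Fin (K j)),
        (W x.1 x.2 : ℝ≥0∞) * ∑ j, (lam j : ℝ≥0∞) * W2sq (g j (x.2 j)) (β x.1)
      = ∑ j, (lam j : ℝ≥0∞) * ∑ x : η × ((j : Fin J) → Fin (K j)),
          (W x.1 x.2 : ℝ≥0∞) * W2sq (g j (x.2 j)) (β x.1) := by
        simp_rw [Finset.mul_sum, mul_left_comm (lam _ : ℝ≥0∞)]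
        exact Finset.sum_comm
    _ = ∑ j, (lam j : ℝ≥0∞) * ∑ k, (u j k : ℝ≥0∞) * W2sq (g j k.1) (β k.2) := by
        simp_rw [Fintype.sum_prod_type_right (α₁ := Fin _), Fintype.sum_prod_type]
        refine Finset.sum_congr rfl fun j _ => congrArg _ <| Finset.sum_congr rfl fun l _ => ?_
        exact sum_smul_comp_eval (hW l) j fun a => W2sq (g j a) (β l)
    _ ≤ ∑ j, (lam j : ℝ≥0∞) * MW2sq (∑ a, p j a • g j a) (∑ l, q l • β l) := by
        gcongr with j
        exact hle j

theorem sum_MW2sq_le_discreteCost [Nonempty (Fin J)] (hlam : ∑ j, lam j = 1)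
    (hp : ∀ j, ∑ a, p j a = 1) (hν : ∀ k, IsGaussian (ν k))
    (c : ∀ k : (j : Fin J) → Fin (K j), BarycentricMaps lam (fun j => g j (k j)) (ν k))
    {w : ((j : Fin J) → Fin (K j)) → ℝ≥0} (hw : w ∈ discreteCouplings p) :
    ∑ j, (lam j : ℝ≥0∞) * MW2sq (∑ a, p j a • g j a) (∑ k, w k • ν k) ≤
      discreteCost lam g w := by
  obtain ⟨j₀⟩ := ‹Nonempty (Fin J)›
  have hw1 : ∑ k, w k = 1 := (sum_eq_of_mem_discreteCouplings hw j₀).trans (hp j₀)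
  calc ∑ j, (lam j : ℝ≥0∞) * MW2sq (∑ a, p j a • g j a) (∑ k, w k • ν k)
      ≤ ∑ j, (lam j : ℝ≥0∞) * ∑ k, (w k : ℝ≥0∞) * ∫⁻ y, ‖y.1 - y.2‖ₑ ^ 2 ∂(c k).plan j := by
        gcongr with j
        rw [← sum_smul_comp_eval hw j (g j)]
        exact MW2sq_sum_smul_le hw1 (fun k => (c k).plan_mem_couplings j)
          fun k => (c k).isGaussian_plan j
    _ = ∑ k, (w k : ℝ≥0∞) * (c k).cost := by
        simp_rw [BarycentricMaps.cost, Finset.mul_sum, mul_left_comm (lam _ : ℝ≥0∞)]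
        exact Finset.sum_comm
    _ = discreteCost lam g w := by
        simp_rw [discreteCost, (c _).mmW2sq_eq_cost hlam (mem_P2_of_isGaussian _)]

theorem exists_discreteCost_le_sum_MW2sq [Nonempty (Fin J)] (hlam : ∑ j, lam j = 1)
    (hp : ∀ j, ∑ a, p j a = 1) (hg : ∀ j a, IsGaussian (g j a)) (hν : ∀ k, IsGaussian (ν k))
    (c : ∀ k : (j : Fin J) → Fin (K j), BarycentricMaps lam (fun j => g j (k j)) (ν k))
    (hρ : ρ ∈ GMMInf (Rd d)) :
    ∃ w ∈ discreteCouplings p,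
      discreteCost lam g w ≤ ∑ j, (lam j : ℝ≥0∞) * MW2sq (∑ a, p j a • g j a) ρ ∧
      (∑ j, (lam j : ℝ≥0∞) * MW2sq (∑ a, p j a • g j a) ρ ≤ discreteCost lam g w →
        ρ = ∑ k, w k • ν k) := by
  obtain ⟨N, q, β, hq, hβ, rfl⟩ := Set.mem_iUnion.mp hρ
  obtain ⟨W, hW, hWq, hle⟩ := exists_tensors_sum_W2sq_le_sum_MW2sq (lam := lam) hp hg hq hβ
  have hP2 : ∀ k, ν k ∈ P2 d := fun k => mem_P2_of_isGaussian _
  have hcost : discreteCost lam g (∑ l, W l) =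
      ∑ x : Fin N × ((j : Fin J) → Fin (K j)), (W x.1 x.2 : ℝ≥0∞) * (c x.2).cost := by
    simp_rw [discreteCost, Fintype.sum_prod_type_right, Finset.sum_apply,
      ENNReal.ofNNReal_finsetSum, Finset.sum_mul, (c _).mmW2sq_eq_cost hlam (hP2 _)]
  have hterm : ∀ x : Fin N × ((j : Fin J) → Fin (K j)), (W x.1 x.2 : ℝ≥0∞) * (c x.2).cost ≤
      (W x.1 x.2 : ℝ≥0∞) * ∑ j, (lam j : ℝ≥0∞) * W2sq (g j (x.2 j)) (β x.1) := fun x => by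
    gcongr
    exact (c x.2).cost_le_sum_W2sq hlam (hP2 _) (mem_P2_of_isGaussian _)
  refine ⟨∑ l, W l, hW, hcost.le.trans ((Finset.sum_le_sum fun x _ => hterm x).trans hle),
    fun hge => ?_⟩
  rw [hcost] at hge
  have hfin : ∑ x : Fin N × ((j : Fin J) → Fin (K j)), (W x.1 x.2 : ℝ≥0∞) * (c x.2).cost ≠ ∞ :=
    ENNReal.sum_ne_top.mpr fun x _ =>
      ENNReal.mul_ne_top ENNReal.coe_ne_top ((c x.2).cost_ne_top (hP2 _))
  have heq : ∀ l k, W l k • β l = W l k • ν k := fun l k => by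
    rcases eq_or_ne (W l k) 0 with h0 | h0
    · simp [h0]
    have hlk := le_of_sum_le_sum_of_forall_le hterm (hle.trans hge) hfin (l, k)
    rw [ENNReal.mul_le_mul_iff_right (by exact_mod_cast h0) ENNReal.coe_ne_top] at hlk
    rw [(c k).eq_of_sum_W2sq_le_cost hlam (hP2 k) (mem_P2_of_isGaussian _) hlk]
  simp_rw [Finset.sum_apply, Finset.sum_smul, ← hWq, Finset.sum_smul, heq]
  exact Finset.sum_comm

lemma isMW2Barycenter_of_isOptimalDiscrete [Nonempty (Fin J)] (hlam : ∑ j, lam j = 1)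
    (hp : ∀ j, ∑ a, p j a = 1) (hg : ∀ j a, IsGaussian (g j a)) (hν : ∀ k, IsGaussian (ν k))
    (c : ∀ k : (j : Fin J) → Fin (K j), BarycentricMaps lam (fun j => g j (k j)) (ν k))
    {w : ((j : Fin J) → Fin (K j)) → ℝ≥0} (hw : IsOptimalDiscrete lam p g w) :
    IsMW2Barycenter lam (fun j => ∑ a, p j a • g j a) (∑ k, w k • ν k) := by
  obtain ⟨j₀⟩ := ‹Nonempty (Fin J)›
  have hw1 : ∑ k, w k = 1 := (sum_eq_of_mem_discreteCouplings hw.1 j₀).trans (hp j₀)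
  refine ⟨sum_smul_mem_GMMInf hw1 hν, fun ρ hρ => ?_⟩
  obtain ⟨w', hw', hle, -⟩ := exists_discreteCost_le_sum_MW2sq hlam hp hg hν c hρ
  exact (sum_MW2sq_le_discreteCost hlam hp hν c hw.1).trans ((hw.2 w' hw').trans hle)

theorem isMW2Barycenter_iff [Nonempty (Fin J)] (hlam : ∑ j, lam j = 1)
    (hp : ∀ j, ∑ a, p j a = 1) (hg : ∀ j a, IsGaussian (g j a)) (hν : ∀ k, IsGaussian (ν k))
    (c : ∀ k : (j : Fin J) → Fin (K j), BarycentricMaps lam (fun j => g j (k j)) (ν k)) :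
    IsMW2Barycenter lam (fun j => ∑ a, p j a • g j a) ρ ↔
      ∃ w, IsOptimalDiscrete lam p g w ∧ ρ = ∑ k, w k • ν k := by
  refine ⟨fun hρ => ?_, ?_⟩
  · obtain ⟨w₀, hw₀⟩ := exists_isOptimalDiscrete (lam := lam) (g := g) hp fun k =>
      (c k).mmW2sq_ne_top hlam (mem_P2_of_isGaussian _)
    obtain ⟨w, hw, hle, heq⟩ := exists_discreteCost_le_sum_MW2sq hlam hp hg hν c hρ.1
    have hρw₀ : ∑ j, (lam j : ℝ≥0∞) * MW2sq (∑ a, p j a • g j a) ρ ≤ discreteCost lam g w₀ :=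
      (hρ.2 _ (isMW2Barycenter_of_isOptimalDiscrete hlam hp hg hν c hw₀).1).trans
        (sum_MW2sq_le_discreteCost hlam hp hν c hw₀.1)
    exact ⟨w, ⟨hw, fun w' hw' => hle.trans (hρw₀.trans (hw₀.2 w' hw'))⟩,
      heq (hρw₀.trans (hw₀.2 w hw))⟩
  · rintro ⟨w, hw, rfl⟩
    exact isMW2Barycenter_of_isOptimalDiscrete hlam hp hg hν c hw

end MW2Barycenters

end GMMOT

open GMMOT in
theorem mainTheorem6 {d J : ℕ} (lam : Fin J → ℝ≥0) (hlam : ∑ j, lam j = 1)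
    (K : Fin J → ℕ) (p : (j : Fin J) → Fin (K j) → ℝ≥0) (hp : ∀ j, ∑ a, p j a = 1)
    (m : (j : Fin J) → Fin (K j) → Rd d)
    (S : (j : Fin J) → Fin (K j) → Matrix (Fin d) (Fin d) ℝ) (hS : ∀ j a, (S j a).PosDef)
    (g : (j : Fin J) → Fin (K j) → Measure (Rd d))
    (hg : ∀ j a, g j a = multivariateGaussian (m j a) (S j a))
    (μ : Fin J → Measure (Rd d)) (hμ : ∀ j, μ j = ∑ a, p j a • g j a) :
    ∃ ν : ((j : Fin J) → Fin (K j)) → Measure (Rd d),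
      -- `ν k` is Gaussian and is the unique `W₂` barycenter of the chosen components
      (∀ k, IsGaussian (ν k) ∧
        ∀ ρ, IsW2Barycenter lam (fun j => g j (k j)) ρ ↔ ρ = ν k) ∧
      -- the `MW₂` barycenters are the mixtures of the `ν k` with optimal weights
      (∀ ρ, IsMW2Barycenter lam μ ρ ↔
        ∃ w, IsOptimalDiscrete lam p g w ∧ ρ = ∑ k, w k • ν k) ∧
      -- some optimal `w` has at most `K 0 + ⋯ + K (J - 1) - J + 1` nonzero coefficients
      ∃ w, IsOptimalDiscrete lam p g w ∧ IsMW2Barycenter lam μ (∑ k, w k • ν k) ∧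
        (Finset.univ.filter (fun k => w k ≠ 0)).card + J ≤ (∑ j, K j) + 1 := by
  obtain rfl : μ = fun j => ∑ a, p j a • g j a := funext hμ
  have : Nonempty (Fin J) := by
    by_contra! h
    simp at hlam
  have hgG : ∀ j a, IsGaussian (g j a) := fun j a => by
    rw [hg]
    infer_instance
  choose ν hν c using fun k : (j : Fin J) → Fin (K j) => exists_barycentricMaps hlam
    (fun j => m j (k j)) (fun j => hS j (k j)) (fun j => hg j (k j))
  replace c k := (c k).some
  have hνP2 : ∀ k, ν k ∈ P2 d := fun k => mem_P2_of_isGaussian (ν k)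
  obtain ⟨w, hw, hcard⟩ :=
    exists_sparse_isOptimalDiscrete hp fun k => (c k).mmW2sq_ne_top hlam (hνP2 k)
  exact ⟨ν, fun k => ⟨hν k, fun ρ => (c k).isW2Barycenter_iff hlam (hνP2 k)⟩,
    fun ρ => isMW2Barycenter_iff hlam hp hgG hν c, w, hw,
    isMW2Barycenter_of_isOptimalDiscrete hlam hp hgG hν c hw, hcard⟩
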